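/- \textbf{Proposition.} Let $X$ be either Cantor space $2^{\omega}$, with the metric $d(x,y)=2^{-n}$ for the largest $n$ such that $x\restriction n=y\restriction n$ (and $d(x,x)=0$), or the unit interval $[0,1]$ with its usual metric. The subsystem $\mathsf{ACA}_0$ of second-order arithmetic (basic axioms of arithmetic, the induction axiom for sets, and comprehension for arithmetical formulas with parameters) proves Cousin's lemma for Baire class 1 gauges on $X$. Equivalently, the following statement, interpreted in $M$, is true in every model $M$ of $\mathsf{ACA}_0$ (not necessarily an $\omega$-model): every Baire class 1 gauge $\delta\colon X\to\mathbb R^+$ has a $\delta$-fine cover. Here a code of a Baire class 1 function $f$ on $X$ is a sequence $\langle f_n\rangle$ of (codes of) continuous functions $f_n\colon X\to\mathbb R$ such that $\langle f_n(x)\rangle$ is a Cauchy sequence for every $x\in X$. For rational $q$, ``$f(x)>q$'' means that for some rational $s>q$ we have $f_n(x)>s$ for all but finitely many $n$; and $f$ is a gauge if $f(x)>0$ for all $x\in X$. A $\delta$-fine cover of $X$ is a finite set $P\subseteq X$ together with a function $p\mapsto r_p$ from $P$ to $\mathbb R^+$ such that $X=\bigcup_{p\in P}B(p,r_p)$, where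 $B(p,r_p)$ is the open ball, and $r_p\le\delta(p)$ for all $p\in P$ (that is, $\delta(p)>q$ for every rational $q<r_p$). All objects (points, real numbers, codes, finite sequences) are those of the model. -/

import Mathlib

/-!
Second-order arithmetic, models of `ACA₀`, and the notions needed to state Cousin's lemma
*inside* a model of second-order arithmetic. From the section on rational numbers onwards, every
definition is the Tarskian reading, in an `L₂`-structure `M`, of a formula of second-order
arithmetic: every number quantifier ranges over `M.Num` (or over triples of elements of `M.Num`,
for rational numbers), and every set quantifier ranges over the second-order part `M.sets`.
-/

universe u

namespace SOA

/-- An `L₂`-structure: a first-order part with `0, 1, +, ·, <`, and a second-order part,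
which is a collection of subsets of the first-order part. It need not be an `ω`-model. -/
structure L2Structure where
  Num : Type u
  [instZero : Zero Num]
  [instOne : One Num]
  [instAdd : Add Num]
  [instMul : Mul Num]
  [instLT : LT Num]
  sets : Set (Set Num)

attribute [instance] L2Structure.instZero L2Structure.instOne L2Structure.instAdd
  L2Structure.instMul L2Structure.instLT

/-- Numerical terms of `L₂`; number variables are de Bruijn indices. -/
inductive Term : Type
  | var (i : ℕ)
  | zero
  | one
  | add (s t : Term)
  | mul (s t : Term)

/-- Arithmetical formulas of `L₂` (no set quantifiers). The free set variables are drawn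
from a type `P`; number variables are de Bruijn indices, and `all` binds the index `0`. -/
inductive ArithFormula (P : Type u) : Type u
  | falsum
  | eq (s t : Term)
  | lt (s t : Term)
  | mem (t : Term) (X : P)
  | imp (φ ψ : ArithFormula P)
  | all (φ : ArithFormula P)

/-- Extend an assignment of the number variables by a value for the index `0`. -/
def extend {N : Type u} (a : N) (v : ℕ → N) : ℕ → N
  | 0 => a
  | i + 1 => v i

namespace L2Structure

variable (M : L2Structure.{u})

/-- The value of a numerical term under an assignment. -/
def termVal (v : ℕ → M.Num) : Term → M.Num
  | .var i => v i
  | .zero => 0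
  | .one => 1
  | .add s t => termVal v s + termVal v t
  | .mul s t => termVal v s * termVal v t

/-- Truth of an arithmetical formula in `M`; the free set variable `X : P` is interpreted
as the set `I X`, the number variable `i` as the number `v i`. -/
def Realize {P : Type u} (I : P → Set M.Num) : (ℕ → M.Num) → ArithFormula P → Prop
  | _, .falsum => False
  | v, .eq s t => M.termVal v s = M.termVal v t
  | v, .lt s t => M.termVal v s < M.termVal v t
  | v, .mem t X => M.termVal v t ∈ I X
  | v, .imp φ ψ => Realize I v φ → Realize I v ψ
  | v, .all φ => ∀ a : M.Num, Realize I (extend a v) φ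

/-- `M` is a model of `ACA₀`: the basic axioms of arithmetic, the induction axiom for sets, and
comprehension for arithmetical formulas with number parameters `v` and with set parameters from
`M.sets` (each member of `M.sets` serves as a set variable denoting itself). -/
structure IsModelACA0 : Prop where
  succ_ne_zero : ∀ m : M.Num, m + 1 ≠ 0
  succ_inj : ∀ m n : M.Num, m + 1 = n + 1 → m = n
  add_zero : ∀ m : M.Num, m + 0 = m
  add_succ : ∀ m n : M.Num, m + (n + 1) = (m + n) + 1
  mul_zero : ∀ m : M.Num, m * 0 = 0
  mul_succ : ∀ m n : M.Num, m * (n + 1) = m * n + m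
  not_lt_zero : ∀ m : M.Num, ¬ m < 0
  lt_succ : ∀ m n : M.Num, m < n + 1 ↔ (m < n ∨ m = n)
  induction : ∀ X ∈ M.sets, (0 : M.Num) ∈ X → (∀ n, n ∈ X → n + 1 ∈ X) → ∀ n, n ∈ X
  comprehension : ∀ (φ : ArithFormula M.sets) (v : ℕ → M.Num),
    {a : M.Num | M.Realize (fun X : M.sets => (X : Set M.Num)) (extend a v) φ} ∈ M.sets

variable {M}

/-! ### Pairs, sequences of sets, powers of two -/

/-- The pairing function `(i, j) = (i + j)² + i`. -/
def pair (i j : M.Num) : M.Num := (i + j) * (i + j) + i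

/-- The `n`-th member `(X)ₙ = {i : (i, n) ∈ X}` of the sequence of sets coded by `X`. -/
def sec (X : Set M.Num) (n : M.Num) : Set M.Num := {i | pair i n ∈ X}

/-- `p = 2ᵏ`: some function `F` in the model satisfies `F(0) = 1`, `F(i+1) = 2 F(i)`, `F(k) = p`. -/
def IsPow2 (k p : M.Num) : Prop :=
  ∃ F ∈ M.sets, (∀ i, ∃! y, pair i y ∈ F) ∧ pair 0 1 ∈ F ∧
    (∀ i y, pair i y ∈ F → pair (i + 1) (y + y) ∈ F) ∧ pair k p ∈ F

/-! ### Rational numbers -/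

/-- The rational number `(pos - neg) / (den + 1)`. -/
@[ext] structure Q (M : L2Structure.{u}) where
  pos : M.Num
  neg : M.Num
  den : M.Num

namespace Q

/-- The number coding (a presentation of) a rational number. -/
def code (q : Q M) : M.Num := pair (pair q.pos q.neg) q.den

instance : Zero (Q M) := ⟨⟨0, 0, 0⟩⟩
instance : One (Q M) := ⟨⟨1, 0, 0⟩⟩

instance : LT (Q M) :=
  ⟨fun x y => x.pos * (y.den + 1) + y.neg * (x.den + 1) <
    y.pos * (x.den + 1) + x.neg * (y.den + 1)⟩

instance : LE (Q M) := ⟨fun x y => ¬ y < x⟩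

instance : Add (Q M) :=
  ⟨fun x y => ⟨x.pos * (y.den + 1) + y.pos * (x.den + 1),
    x.neg * (y.den + 1) + y.neg * (x.den + 1), x.den * y.den + x.den + y.den⟩⟩

instance : Neg (Q M) := ⟨fun x => ⟨x.neg, x.pos, x.den⟩⟩

instance : Sub (Q M) := ⟨fun x y => x + -y⟩

/-- `e = 2⁻ᵏ` (in the presentation with numerator `1`). -/
def IsHalfPow (k : M.Num) (e : Q M) : Prop := e.pos = 1 ∧ e.neg = 0 ∧ IsPow2 k (e.den + 1)

end Q

/-! ### Real numbers -/

/-- The sequence of rationals coded by `x` has `n`-th term `q`. -/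
def HasTerm (x : Set M.Num) (n : M.Num) (q : Q M) : Prop := pair n q.code ∈ x

/-- A real number of `M`: a set in the model that is a sequence `⟨q₀, q₁, …⟩` of rational numbers
with `|qᵢ - qⱼ| ≤ 2⁻ⁱ` for `i < j`. -/
def IsReal (x : Set M.Num) : Prop :=
  x ∈ M.sets ∧ (∀ z ∈ x, ∃ (n : M.Num) (q : Q M), z = pair n q.code) ∧
  (∀ n, ∃! q : Q M, HasTerm x n q) ∧
  ∀ (i j : M.Num) (p q e : Q M), i < j → HasTerm x i p → HasTerm x j q → Q.IsHalfPow i e →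
    p - q ≤ e ∧ q - p ≤ e

/-- `q < x` for `q` rational and `x` real. -/
def QltR (q : Q M) (x : Set M.Num) : Prop :=
  ∃ (k : M.Num) (p e : Q M), HasTerm x k p ∧ Q.IsHalfPow k e ∧ q < p - e

/-- `x < q` for `q` rational and `x` real. -/
def RltQ (x : Set M.Num) (q : Q M) : Prop :=
  ∃ (k : M.Num) (p e : Q M), HasTerm x k p ∧ Q.IsHalfPow k e ∧ p + e < q

/-- `|x - y| < q` for `q` rational and `x`, `y` real. -/
def RdistLT (x y : Set M.Num) (q : Q M) : Prop :=
  ∃ (k : M.Num) (a b e : Q M), HasTerm x k a ∧ HasTerm y k b ∧ Q.IsHalfPow k e ∧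
    (a - b) + (e + e) < q ∧ (b - a) + (e + e) < q

/-- Equality of real numbers. -/
def Req (x y : Set M.Num) : Prop := ∀ q : Q M, 0 < q → RdistLT x y q

/-! ### The two spaces -/

/-- How a complete separable metric space is presented in `M`: its points (sets in the model),
the numbers that code the elements of a countable dense subset, the point coded by such a number,
and the relation `d(x, y) < q` for points `x`, `y` and rational numbers `q`. Only the two
presentations `cantor` and `unitInterval` below are ever used. -/
structure Presentation (M : L2Structure.{u}) where
  IsPoint : Set M.Num → Prop
  IsCenter : M.Num → Prop
  center : M.Num → Set M.Num
  DistLT : Set M.Num → Set M.Num → Q M → Prop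

/-- `i` is a member of the finite set with binary code `a`: the digit of `2ⁱ` in `a` is `1`. -/
def Bit (i a : M.Num) : Prop :=
  ∃ p w v : M.Num, IsPow2 i p ∧ v < p ∧ a = (w + w + 1) * p + v

/-- Cantor space: the points are the sets `x` of the model (identified with their characteristic
functions), `d(x, y) = 2⁻ⁿ` for the largest `n` with `x ↾ n = y ↾ n`, and `d(x, x) = 0`. The finite
sets form the countable dense subset. -/
def cantor (M : L2Structure.{u}) : Presentation M where
  IsPoint x := x ∈ M.sets
  IsCenter _ := True
  center a := {i | Bit i a}
  DistLT x y q := 0 < q ∧ ∀ n : M.Num, (∀ i, i < n → (i ∈ x ↔ i ∈ y)) → ¬ (n ∈ x ↔ n ∈ y) →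
    ∃ e : Q M, Q.IsHalfPow n e ∧ e < q

/-- The unit interval: the points are the real numbers `x` with `0 ≤ x ≤ 1`, the distance is
`|x - y|`, and the countable dense subset consists of the rational numbers in `[0, 1]`. -/
def unitInterval (M : L2Structure.{u}) : Presentation M where
  IsPoint x := IsReal x ∧ ¬ RltQ x 0 ∧ ¬ QltR 1 x
  IsCenter a := ∃ q : Q M, a = q.code ∧ 0 ≤ q ∧ q ≤ 1
  center a := {z | ∃ n, z = pair n a}
  DistLT := RdistLT

namespace Presentation

variable (X : Presentation M)

/-- `x` and `y` are the same point: `d(x, y) = 0`. -/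
def PtEq (x y : Set M.Num) : Prop := ∀ q : Q M, 0 < q → X.DistLT x y q

/-! ### Codes of continuous functions -/

/-- `(a, r) Φ (b, s)`: according to the code `Φ`, the function maps the open ball `B(a, r)` of `X`
into the closed ball of radius `s` about `b` in `ℝ`. -/
def Maps (Φ : Set M.Num) (a : M.Num) (r b s : Q M) : Prop :=
  X.IsCenter a ∧ 0 < r ∧ 0 < s ∧
    ∃ n : M.Num, pair n (pair a (pair r.code (pair b.code s.code))) ∈ Φ

/-- `Φ` is a code of a continuous function, defined on all of `X`, with values in `ℝ`.
The third clause is about `B(a', r') < B(a, r)`, that is, `d(a, a') + r' < r`; the last one says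
that every point is in the domain of the function. -/
def IsContinuousCode (Φ : Set M.Num) : Prop :=
  Φ ∈ M.sets ∧
  (∀ a r b s b' s', X.Maps Φ a r b s → X.Maps Φ a r b' s' → b - b' ≤ s + s' ∧ b' - b ≤ s + s') ∧
  (∀ a r b s a' r', X.Maps Φ a r b s → X.IsCenter a' → 0 < r' →
    X.DistLT (X.center a) (X.center a') (r - r') → X.Maps Φ a' r' b s) ∧
  (∀ a r b s b' s', X.Maps Φ a r b s → (b - b') + s < s' → (b' - b) + s < s' →
    X.Maps Φ a r b' s') ∧
  (∀ x, X.IsPoint x → ∀ ε : Q M, 0 < ε →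
    ∃ a r b s, X.Maps Φ a r b s ∧ X.DistLT x (X.center a) r ∧ s < ε)

/-- `f(x) = y`, where `f` is the function coded by `Φ`: `y` is a real number, and `|y - b| ≤ s`
whenever `(a, r) Φ (b, s)` and `d(x, a) < r`. -/
def HasValue (Φ x y : Set M.Num) : Prop :=
  IsReal y ∧ ∀ a r b s, X.Maps Φ a r b s → X.DistLT x (X.center a) r →
    ¬ RltQ y (b - s) ∧ ¬ QltR (b + s) y

/-! ### Codes of Baire class 1 functions, gauges and fine covers -/

/-- `D` codes a Baire class 1 function on `X`: it is a sequence `⟨fₙ⟩` of codes of continuous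
functions such that `⟨fₙ(x)⟩` is a Cauchy sequence for every point `x` (its limit is not required
to exist in the model). -/
def IsBaireOneCode (D : Set M.Num) : Prop :=
  D ∈ M.sets ∧ (∀ n, X.IsContinuousCode (sec D n)) ∧
  ∀ x, X.IsPoint x → ∀ ε : Q M, 0 < ε → ∃ N : M.Num, ∀ m n, N < m → N < n →
    ∃ y z, X.HasValue (sec D m) x y ∧ X.HasValue (sec D n) x z ∧ RdistLT y z ε

/-- `δ(x) > q`, where `δ` is the Baire class 1 function with code `D`: for some `s > q`, for all
but finitely many `n`, `fₙ(x) > s`. -/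
def ValueGT (D x : Set M.Num) (q : Q M) : Prop :=
  ∃ s : Q M, q < s ∧ ∃ N : M.Num, ∀ n, N < n → ∃ y, X.HasValue (sec D n) x y ∧ QltR s y

/-- `D` codes a Baire class 1 gauge `δ : X → ℝ⁺`. -/
def IsBaireOneGauge (D : Set M.Num) : Prop :=
  X.IsBaireOneCode D ∧ ∀ x, X.IsPoint x → X.ValueGT D x 0

/-- The Baire class 1 gauge `δ` with code `D` has a `δ`-fine cover: a finite set
`{pᵢ : i < k}` of points of `X`, with a function `pᵢ ↦ rᵢ` into `ℝ⁺`, such that `rᵢ ≤ δ(pᵢ)`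
for all `i < k` (that is, `δ(pᵢ) > q` for all rational `q < rᵢ`) and the open balls `B(pᵢ, rᵢ)` cover
`X`. Finiteness is in the sense of the model: `k` is an element of `M.Num`, and the finite sequences
`⟨pᵢ⟩` and `⟨rᵢ⟩` are coded by sets in the model. -/
def HasFineCover (D : Set M.Num) : Prop :=
  ∃ (k : M.Num), ∃ P ∈ M.sets, ∃ R ∈ M.sets,
    (∀ i, i < k → X.IsPoint (sec P i) ∧ IsReal (sec R i) ∧ QltR 0 (sec R i) ∧
      ∀ q : Q M, QltR q (sec R i) → X.ValueGT D (sec P i) q) ∧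
    (∀ i j, i < k → j < k → X.PtEq (sec P i) (sec P j) → Req (sec R i) (sec R j)) ∧
    ∀ x, X.IsPoint x → ∃ i, i < k ∧ ∃ q : Q M, X.DistLT x (sec P i) q ∧ QltR q (sec R i)

/-- Cousin's lemma for Baire class 1 functions on `X`, as a statement interpreted in `M`. -/
def CousinBaireOne : Prop := ∀ D, X.IsBaireOneGauge D → X.HasFineCover D

end Presentation

end L2Structure

end SOA

/-! Fix a gauge δ, the limit of ⟨fₙ⟩. Each point x has numbers N and j with fₙ(x) ≥ 2⁻ʲ for all n >
N; then δ(x) ≥ 2⁻ʲ. For fixed N and j the points with this property form a closed set. Call a dyadic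
cell of level j + 1 tagged if it meets that closed set for some N. Every point lies in a tagged
cell, so by compactness there is a level L such that every cell of level L is contained in a tagged
cell of level at most L. Choose a witness in each of these tagged cells. A tagged cell of level j +
1 has diameter at most 2⁻⁽ʲ⁺¹⁾, so the ball of radius 2⁻ʲ about its witness covers it, and that
radius is allowed by δ.

The difficulty is to stay within arithmetical comprehension. "Some point of the cell lies in the
closed set" quantifies over sets. By weak König's lemma it is equivalent to the existence, at every
length, of a string that avoids a definable family (`Extendible`), which is arithmetical; a witness
is then the leftmost branch (`branch`), uniformly definable in the cell. This is carried by
`not_restr_branch` and `extendible_of_avoids`. All remaining choices are least numbers, so the whole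
finite cover is given by sets of the model.

The argument is carried out once, in `CantorImage.cousinBaireOne`, for a space parametrized by
Cantor space. Cantor space is parametrized by the identity and the unit interval by binary
expansions.

Since M may be nonstandard, arithmetic, rationals, finite sets, recursion and powers of two are
developed inside M. The type classes `ADef` and `DefFun` record arithmetical definability, so that
instance search discharges the side condition of each induction and comprehension. -/

set_option linter.unusedSectionVars false

namespace SOA

/-! ### Arithmetically definable relations and functions -/

/-- Renaming of the variables of a term. -/
def Term.rename (ρ : ℕ → ℕ) : Term → Term
  | .var i => .var (ρ i)
  | .zero => .zero
  | .one => .one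
  | .add s t => .add (s.rename ρ) (t.rename ρ)
  | .mul s t => .mul (s.rename ρ) (t.rename ρ)

/-- Lift a renaming below a quantifier. -/
def liftRenaming (ρ : ℕ → ℕ) : ℕ → ℕ
  | 0 => 0
  | i + 1 => ρ i + 1

/-- Renaming of the free number variables of a formula. -/
def ArithFormula.rename {P : Type u} : (ℕ → ℕ) → ArithFormula P → ArithFormula P
  | _, .falsum => .falsum
  | ρ, .eq s t => .eq (s.rename ρ) (t.rename ρ)
  | ρ, .lt s t => .lt (s.rename ρ) (t.rename ρ)
  | ρ, .mem t X => .mem (t.rename ρ) X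
  | ρ, .imp φ ψ => .imp (φ.rename ρ) (ψ.rename ρ)
  | ρ, .all φ => .all (φ.rename (liftRenaming ρ))

namespace L2Structure

variable {M : L2Structure.{u}}

theorem termVal_rename (ρ : ℕ → ℕ) (v : ℕ → M.Num) (t : Term) :
    M.termVal v (t.rename ρ) = M.termVal (fun i => v (ρ i)) t := by
  induction t with
  | var i => rfl
  | zero => rfl
  | one => rfl
  | add s t hs ht => simp only [Term.rename, termVal, hs, ht]
  | mul s t hs ht => simp only [Term.rename, termVal, hs, ht]

theorem extend_liftRenaming {N : Type u} (a : N) (v : ℕ → N) (ρ : ℕ → ℕ) :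
    (fun i => extend a v (liftRenaming ρ i)) = extend a (fun i => v (ρ i)) := by
  funext i
  cases i <;> rfl

theorem realize_rename {P : Type u} (I : P → Set M.Num) (φ : ArithFormula P) :
    ∀ (ρ : ℕ → ℕ) (v : ℕ → M.Num),
      M.Realize I v (φ.rename ρ) ↔ M.Realize I (fun i => v (ρ i)) φ := by
  induction φ with
  | falsum => exact fun _ _ => Iff.rfl
  | eq s t => intro ρ v; simp only [ArithFormula.rename, Realize, termVal_rename]
  | lt s t => intro ρ v; simp only [ArithFormula.rename, Realize, termVal_rename]
  | mem t X => intro ρ v; simp only [ArithFormula.rename, Realize, termVal_rename]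
  | imp φ ψ hφ hψ => intro ρ v; simp only [ArithFormula.rename, Realize, hφ, hψ]
  | all φ hφ =>
    intro ρ v
    simp only [ArithFormula.rename, Realize, hφ, extend_liftRenaming]

/-- A relation on assignments that is defined by an arithmetical formula with set parameters. -/
class ADef (p : (ℕ → M.Num) → Prop) : Prop where
  out : ∃ φ : ArithFormula M.sets, ∀ v,
    p v ↔ M.Realize (fun X : M.sets => (X : Set M.Num)) v φ

/-- A function on assignments with arithmetical graph. -/
class DefFun (t : (ℕ → M.Num) → M.Num) : Prop where
  graph : ADef fun v : ℕ → M.Num => v 0 = t (fun i => v (i + 1))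

namespace ADef

variable {p q : (ℕ → M.Num) → Prop}

theorem congr (h : ∀ v, p v ↔ q v) [hq : ADef q] : ADef p :=
  ⟨hq.out.imp fun _ hφ v => (h v).trans (hφ v)⟩

theorem rename (hp : ADef p) (ρ : ℕ → ℕ) : ADef fun v => p (fun i => v (ρ i)) := by
  obtain ⟨φ, hφ⟩ := hp.out
  exact ⟨φ.rename ρ, fun v => by rw [hφ, realize_rename]⟩

instance (priority := low) shift (ρ : ℕ → ℕ) [hp : ADef p] :
    ADef fun v => p (fun i => v (ρ i)) := hp.rename ρ

instance false : ADef fun _ : ℕ → M.Num => False := ⟨.falsum, fun _ => Iff.rfl⟩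

instance imp [hp : ADef p] [hq : ADef q] : ADef fun v => p v → q v := by
  obtain ⟨φ, hφ⟩ := hp.out
  obtain ⟨ψ, hψ⟩ := hq.out
  exact ⟨.imp φ ψ, fun v => by simp only [Realize, hφ, hψ]⟩

instance not [ADef p] : ADef fun v => ¬ p v := imp (q := fun _ => False)

instance true : ADef fun _ : ℕ → M.Num => True :=
  congr (q := fun _ => ¬ False) fun _ => by simp

instance and [ADef p] [ADef q] : ADef fun v => p v ∧ q v :=
  congr (q := fun v => ¬ (p v → ¬ q v)) fun _ => by tauto

instance or [ADef p] [ADef q] : ADef fun v => p v ∨ q v :=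
  congr (q := fun v => ¬ p v → q v) fun _ => by tauto

instance iff [ADef p] [ADef q] : ADef fun v => p v ↔ q v :=
  congr (q := fun v => (p v → q v) ∧ (q v → p v)) fun _ => by tauto

instance all {r : M.Num → (ℕ → M.Num) → Prop}
    [hr : ADef fun v => r (v 0) (fun i => v (i + 1))] : ADef fun v => ∀ a, r a v := by
  obtain ⟨φ, hφ⟩ := hr.out
  exact ⟨.all φ, fun v => forall_congr' fun a => hφ (extend a v)⟩

instance ex {r : M.Num → (ℕ → M.Num) → Prop}
    [ADef fun v => r (v 0) (fun i => v (i + 1))] : ADef fun v => ∃ a, r a v :=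
  congr (q := fun v => ¬ ∀ a, ¬ r a v) fun _ => by simp

end ADef

namespace DefFun

variable {p : (ℕ → M.Num) → Prop} {s t : (ℕ → M.Num) → M.Num}

theorem of_graph {r : M.Num → (ℕ → M.Num) → Prop} (h : ∀ v y, y = t v ↔ r y v)
    [ADef fun v => r (v 0) (fun i => v (i + 1))] : DefFun t :=
  ⟨ADef.congr (q := fun v => r (v 0) (fun i => v (i + 1))) fun _ => h _ _⟩

instance (priority := low) shift (ρ : ℕ → ℕ) [ht : DefFun t] :
    DefFun fun v => t (fun i => v (ρ i)) :=
  ⟨by simpa using ht.graph.rename (fun i => Nat.casesOn i 0 fun j => ρ j + 1)⟩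

instance var (n : ℕ) : DefFun fun v : ℕ → M.Num => v n :=
  ⟨⟨.eq (.var 0) (.var (n + 1)), fun _ => Iff.rfl⟩⟩

/-- A definable function need not be a term of the language, so substitution goes through its graph:
the value is named by an existential quantifier. -/
theorem adef_comp {r : M.Num → (ℕ → M.Num) → Prop} [ht : DefFun t]
    [h : ADef fun v => r (v 0) (fun i => v (i + 1))] : ADef fun v => r (t v) v :=
  have := ht.graph
  ADef.congr (q := fun v => ∃ y, y = t v ∧ r y v) fun _ => by simp

theorem _root_.SOA.L2Structure.ADef.subst {p : M.Num → (ℕ → M.Num) → Prop}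
    [hp : ADef fun v => p (v 0) (fun i => v (i + 1))] (ρ : ℕ → ℕ) (t : (ℕ → M.Num) → M.Num)
    [DefFun t] : ADef fun v => p (t v) (fun i => v (ρ i)) :=
  have := hp.rename (fun i => Nat.casesOn i 0 fun j => ρ j + 1)
  adef_comp (r := fun y v => p y (fun i => v (ρ i)))

theorem adef_comp₂ {R : M.Num → M.Num → Prop} [hs : DefFun s] [ht : DefFun t]
    [hR : ADef fun v => R (v 1) (v 0)] : ADef fun v => R (s v) (t v) := by
  have h1 : ADef fun v => R (v 0) (t (fun i => v (i + 1))) :=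
    have := ht.shift (· + 1)
    adef_comp (t := fun v => t (fun i => v (i + 1))) (r := fun z v => R (v 0) z)
  exact adef_comp (r := fun y v => R y (t v))

instance eq [DefFun s] [DefFun t] : ADef fun v => s v = t v :=
  adef_comp₂ (R := fun a b => a = b) (hR := ⟨.eq (.var 1) (.var 0), fun _ => Iff.rfl⟩)

instance lt [DefFun s] [DefFun t] : ADef fun v => s v < t v :=
  adef_comp₂ (R := fun a b => a < b) (hR := ⟨.lt (.var 1) (.var 0), fun _ => Iff.rfl⟩)

theorem comp₂ {f : M.Num → M.Num → M.Num} [hs : DefFun s] [ht : DefFun t]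
    [hf : ADef fun v => v 0 = f (v 1) (v 2)] : DefFun fun v => f (s v) (t v) := by
  have h1 := hf.rename (fun i => Nat.casesOn i 2 fun j => Nat.casesOn j 1 fun _ => 0)
  exact of_graph (r := fun y v => ∃ a, a = s v ∧ ∃ b, b = t v ∧ y = f a b) (by simp)

instance add [DefFun s] [DefFun t] : DefFun fun v => s v + t v :=
  comp₂ (f := fun a b => a + b)
    (hf := ⟨.eq (.var 0) (.add (.var 1) (.var 2)), fun _ => Iff.rfl⟩)

instance mul [DefFun s] [DefFun t] : DefFun fun v => s v * t v :=
  comp₂ (f := fun a b => a * b)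
    (hf := ⟨.eq (.var 0) (.mul (.var 1) (.var 2)), fun _ => Iff.rfl⟩)

instance ite [ADef p] [DefFun s] [DefFun t] [∀ v, Decidable (p v)] :
    DefFun fun v => if p v then s v else t v :=
  of_graph (r := fun y v => (p v ∧ y = s v) ∨ (¬ p v ∧ y = t v)) fun v y => by
    by_cases h : p v <;> simp [h]

end DefFun

variable [hM : Fact M.IsModelACA0]

theorem comprehension {p : (ℕ → M.Num) → Prop} (hp : ADef p) (v : ℕ → M.Num) :
    {a | p (extend a v)} ∈ M.sets := by
  obtain ⟨φ, hφ⟩ := hp.out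
  simpa only [hφ] using hM.out.comprehension φ v

theorem setOf_mem (p : M.Num → Prop) [hp : ADef fun v => p (v 0)] : {a | p a} ∈ M.sets :=
  comprehension hp fun _ => 0

/-- Number parameters are traded for set parameters: the singleton of `c` belongs to the model, and
membership in it defines `c`. Hence `ADef` needs no parameters for numbers. -/
instance DefFun.const (c : M.Num) : DefFun fun _ => c := by
  have h : {a | a = c} ∈ M.sets :=
    hM.out.comprehension (.eq (.var 0) (.var 1)) fun _ => c
  exact ⟨⟨.mem (.var 0) ⟨_, h⟩, fun _ => Iff.rfl⟩⟩

instance ADef.const (c : Prop) : ADef fun _ : ℕ → M.Num => c := by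
  by_cases h : c
  · simpa [h] using ADef.true
  · simpa [h] using ADef.false

instance ADef.mem {X : Set M.Num} [hX : Fact (X ∈ M.sets)] {t : (ℕ → M.Num) → M.Num} [DefFun t] :
    ADef fun v => t v ∈ X :=
  DefFun.adef_comp (r := fun a _ => a ∈ X)
    (h := ⟨.mem (.var 0) ⟨X, hX.out⟩, fun _ => Iff.rfl⟩)

/-- Set induction together with arithmetical comprehension yields induction for every arithmetical
property. All of the arithmetic below rests on this. -/
theorem induct {p : M.Num → Prop} (h0 : p 0) (hs : ∀ n, p n → p (n + 1))
    [ADef fun v => p (v 0)] (n : M.Num) : p n :=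
  hM.out.induction _ (setOf_mem p) h0 hs n

/-! ### Arithmetic in a model of `ACA₀` -/

theorem num_zero_add (n : M.Num) : 0 + n = n :=
  induct (p := fun n => 0 + n = n) (hM.out.add_zero 0)
    (fun n ih => by rw [hM.out.add_succ, ih]) n

theorem num_add_assoc (a b c : M.Num) : a + b + c = a + (b + c) :=
  induct (p := fun c => a + b + c = a + (b + c)) (by simp only [hM.out.add_zero])
    (fun n ih => by simp only [hM.out.add_succ, ih]) c

theorem num_succ_add (a b : M.Num) : a + 1 + b = a + b + 1 :=
  induct (p := fun b => a + 1 + b = a + b + 1) (by simp only [hM.out.add_zero])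
    (fun n ih => by simp only [hM.out.add_succ, ih]) b

theorem num_add_comm (a b : M.Num) : a + b = b + a :=
  induct (p := fun b => a + b = b + a) (by rw [hM.out.add_zero, num_zero_add])
    (fun n ih => by rw [hM.out.add_succ, num_succ_add, ih]) b

instance : AddCommSemigroup M.Num where
  add_assoc := num_add_assoc
  add_comm := num_add_comm

theorem num_zero_mul (n : M.Num) : 0 * n = 0 :=
  induct (p := fun n => 0 * n = 0) (hM.out.mul_zero 0)
    (fun n ih => by rw [hM.out.mul_succ, ih, hM.out.add_zero]) n

theorem num_succ_mul (a b : M.Num) : (a + 1) * b = a * b + b :=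
  induct (p := fun b => (a + 1) * b = a * b + b)
    (by simp only [hM.out.mul_zero, hM.out.add_zero])
    (fun n ih => by simp only [hM.out.mul_succ, ih]; ac_rfl) b

theorem num_mul_comm (a b : M.Num) : a * b = b * a :=
  induct (p := fun b => a * b = b * a) (by rw [hM.out.mul_zero, num_zero_mul])
    (fun n ih => by rw [hM.out.mul_succ, num_succ_mul, ih]) b

theorem num_mul_add (a b c : M.Num) : a * (b + c) = a * b + a * c :=
  induct (p := fun c => a * (b + c) = a * b + a * c)
    (by simp only [hM.out.mul_zero, hM.out.add_zero])
    (fun n ih => by simp only [hM.out.add_succ, hM.out.mul_succ, ih]; ac_rfl) c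

theorem num_mul_assoc (a b c : M.Num) : a * b * c = a * (b * c) :=
  induct (p := fun c => a * b * c = a * (b * c)) (by simp only [hM.out.mul_zero])
    (fun n ih => by simp only [hM.out.mul_succ, num_mul_add, ih]) c

theorem num_mul_one (a : M.Num) : a * 1 = a := by
  rw [← num_zero_add (1 : M.Num), hM.out.mul_succ, hM.out.mul_zero, num_zero_add]

instance : CommSemiring M.Num where
  zero_add := num_zero_add
  add_zero := hM.out.add_zero
  add_comm := num_add_comm
  left_distrib := num_mul_add
  right_distrib a b c := by rw [num_mul_comm, num_mul_add, num_mul_comm c, num_mul_comm c]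
  zero_mul := num_zero_mul
  mul_zero := hM.out.mul_zero
  mul_assoc := num_mul_assoc
  one_mul a := by rw [num_mul_comm, num_mul_one]
  mul_one := num_mul_one
  mul_comm := num_mul_comm
  nsmul := nsmulRec

theorem num_add_right_cancel {a b c : M.Num} (h : a + c = b + c) : a = b := by
  revert h
  refine induct (p := fun c => a + c = b + c → a = b) (by simp) (fun n ih h => ?_) c
  rw [← add_assoc, ← add_assoc] at h
  exact ih (hM.out.succ_inj _ _ h)

instance : IsCancelAdd M.Num :=
  have : IsRightCancelAdd M.Num := ⟨fun _ _ _ h => num_add_right_cancel h⟩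
  AddCommMagma.IsRightCancelAdd.toIsCancelAdd _

theorem num_eq_zero_or_succ (n : M.Num) : n = 0 ∨ ∃ m, n = m + 1 :=
  induct (p := fun n => n = 0 ∨ ∃ m, n = m + 1) (Or.inl rfl) (fun n _ => Or.inr ⟨n, rfl⟩) n

theorem num_lt_iff_exists (a b : M.Num) : a < b ↔ ∃ c, b = a + (c + 1) := by
  refine induct (p := fun b => a < b ↔ ∃ c, b = a + (c + 1)) ?_ (fun b ih => ?_) b
  · refine iff_of_false (hM.out.not_lt_zero a) fun ⟨c, hc⟩ => ?_
    rw [← add_assoc] at hc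
    exact hM.out.succ_ne_zero _ hc.symm
  · rw [hM.out.lt_succ, ih]
    constructor
    · rintro (⟨c, rfl⟩ | rfl)
      · exact ⟨c + 1, by ring⟩
      · exact ⟨0, by ring⟩
    · rintro ⟨c, hc⟩
      rw [← add_assoc] at hc
      have hc := add_right_cancel hc
      rcases num_eq_zero_or_succ c with rfl | ⟨d, rfl⟩
      · exact Or.inr (by rw [hc, add_zero])
      · exact Or.inl ⟨d, hc⟩

theorem num_lt_trichotomy (a b : M.Num) : a < b ∨ a = b ∨ b < a := by
  refine induct (p := fun b => a < b ∨ a = b ∨ b < a) ?_ (fun b ih => ?_) b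
  · rcases num_eq_zero_or_succ a with rfl | ⟨d, rfl⟩
    · simp
    · exact Or.inr (Or.inr ((num_lt_iff_exists _ _).2 ⟨d, by ring⟩))
  · rcases ih with h | rfl | h
    · exact Or.inl ((hM.out.lt_succ _ _).2 (Or.inl h))
    · exact Or.inl ((hM.out.lt_succ _ _).2 (Or.inr rfl))
    · obtain ⟨c, rfl⟩ := (num_lt_iff_exists _ _).1 h
      rcases num_eq_zero_or_succ c with rfl | ⟨d, rfl⟩
      · exact Or.inr (Or.inl (by ring))
      · exact Or.inr (Or.inr ((num_lt_iff_exists _ _).2 ⟨d, by ring⟩))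

theorem num_lt_irrefl (a : M.Num) : ¬ a < a := fun h => by
  obtain ⟨c, hc⟩ := (num_lt_iff_exists _ _).1 h
  exact hM.out.succ_ne_zero c (add_left_cancel (a := a) (by rw [← hc, add_zero]))

theorem num_lt_trans {a b c : M.Num} (h : a < b) (h' : b < c) : a < c := by
  obtain ⟨d, rfl⟩ := (num_lt_iff_exists _ _).1 h
  obtain ⟨e, rfl⟩ := (num_lt_iff_exists _ _).1 h'
  exact (num_lt_iff_exists _ _).2 ⟨d + e + 1, by ring⟩

noncomputable instance : LinearOrder M.Num where
  le a b := ¬ b < a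
  le_refl := num_lt_irrefl
  le_trans a b c h h' hca := by
    rcases num_lt_trichotomy b c with hb | rfl | hb
    · exact h (num_lt_trans hb hca)
    · exact h hca
    · exact h' hb
  lt_iff_le_not_ge a b := by
    constructor
    · exact fun h => ⟨fun h' => num_lt_irrefl _ (num_lt_trans h h'), fun h' => h' h⟩
    · exact fun h => not_not.1 h.2
  le_antisymm a b h h' := by
    rcases num_lt_trichotomy a b with hb | hb | hb
    · exact (h' hb).elim
    · exact hb
    · exact (h hb).elim
  le_total a b := by
    by_contra! h
    exact num_lt_irrefl _ (num_lt_trans h.1 h.2)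
  toDecidableLE := Classical.decRel _

theorem num_zero_lt_succ (a : M.Num) : 0 < a + 1 := (num_lt_iff_exists _ _).2 ⟨a, by ring⟩

instance : IsStrictOrderedRing M.Num :=
  have : IsOrderedAddMonoid M.Num :=
    ⟨fun a b h c => by
      rcases h.lt_or_eq with h | rfl
      · obtain ⟨d, rfl⟩ := (num_lt_iff_exists _ _).1 h
        exact ((num_lt_iff_exists _ _).2 ⟨d, by ring⟩).le
      · exact le_rfl,
    fun a b h c => by
      rcases h.lt_or_eq with h | rfl
      · obtain ⟨d, rfl⟩ := (num_lt_iff_exists _ _).1 h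
        exact ((num_lt_iff_exists _ _).2 ⟨d, by ring⟩).le
      · exact le_rfl⟩
  have hcancel : ∀ a b c : M.Num, a + b ≤ a + c → b ≤ c := fun a b c h => by
    by_contra! hcb
    obtain ⟨d, rfl⟩ := (num_lt_iff_exists _ _).1 hcb
    exact h ((num_lt_iff_exists _ _).2 ⟨d, by ring⟩)
  have : IsOrderedCancelAddMonoid M.Num :=
    ⟨hcancel, fun a b c h => hcancel a b c (by simpa only [add_comm] using h)⟩
  have hmul : ∀ a : M.Num, 0 < a → ∀ b c, b < c → a * b < a * c := fun a ha b c h => by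
    obtain ⟨d, rfl⟩ := (num_lt_iff_exists _ _).1 h
    obtain ⟨e, rfl⟩ := (num_lt_iff_exists _ _).1 ha
    exact (num_lt_iff_exists _ _).2 ⟨d + e + d * e, by ring⟩
  { zero_le_one := by simpa using (num_zero_lt_succ (0 : M.Num)).le
    exists_pair_ne := ⟨0, 1, fun h => hM.out.succ_ne_zero (0 : M.Num) (by rw [zero_add, h])⟩
    mul_lt_mul_of_pos_left := fun a ha b c h => hmul a ha b c h
    mul_lt_mul_of_pos_right := fun a ha b c h => by
      simpa only [mul_comm] using hmul a ha b c h }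

theorem num_nonneg (a : M.Num) : 0 ≤ a := hM.out.not_lt_zero a

instance : CanonicallyOrderedAdd M.Num where
  exists_add_of_le {a b} h := by
    rcases h.lt_or_eq with h | rfl
    · obtain ⟨c, hc⟩ := (num_lt_iff_exists _ _).1 h
      exact ⟨c + 1, hc⟩
    · exact ⟨0, by simp⟩
  le_self_add a b := le_add_of_nonneg_right (num_nonneg b)
  le_add_self a b := le_add_of_nonneg_left (num_nonneg b)

theorem num_lt_succ_iff {a b : M.Num} : a < b + 1 ↔ a ≤ b := by
  rw [hM.out.lt_succ, le_iff_lt_or_eq]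

theorem num_succ_le_iff {a b : M.Num} : a + 1 ≤ b ↔ a < b := by
  rw [← not_lt, num_lt_succ_iff, not_le]

instance {s t : (ℕ → M.Num) → M.Num} [DefFun s] [DefFun t] : ADef fun v => s v ≤ t v :=
  ADef.not (p := fun v => t v < s v)

theorem strong_induct {p : M.Num → Prop} [ADef fun v => p (v 0)]
    (h : ∀ n, (∀ m, m < n → p m) → p n) (n : M.Num) : p n :=
  h n <| induct (p := fun n => ∀ m, m < n → p m) (fun m hm => (hM.out.not_lt_zero m hm).elim)
    (fun n ih m hm => by
      rcases (num_lt_succ_iff.1 hm).lt_or_eq with hm | rfl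
      exacts [ih m hm, h m ih]) n

theorem exists_least {p : M.Num → Prop} [ADef fun v => p (v 0)] (h : ∃ n, p n) :
    ∃ n, p n ∧ ∀ m, p m → n ≤ m := by
  by_contra! hc
  obtain ⟨n, hn⟩ := h
  refine strong_induct (p := fun n => ¬ p n) (fun n ih hp => ?_) n hn
  obtain ⟨m, hm, hmn⟩ := hc n hp
  exact ih m hmn hm

/-- The least `n` with `p n`, if there is one. -/
noncomputable def least (p : M.Num → Prop) : M.Num :=
  open Classical in if h : ∃ n, p n ∧ ∀ m, p m → n ≤ m then h.choose else 0

theorem least_spec {p : M.Num → Prop} [ADef fun v => p (v 0)] (h : ∃ n, p n) : p (least p) := by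
  have h := exists_least h
  rw [least, dif_pos h]
  exact h.choose_spec.1

theorem least_le {p : M.Num → Prop} {n : M.Num} [ADef fun v => p (v 0)] (hn : p n) :
    least p ≤ n := by
  have h := exists_least ⟨n, hn⟩
  rw [least, dif_pos h]
  exact h.choose_spec.2 n hn

instance DefFun.least {p : M.Num → (ℕ → M.Num) → Prop}
    [ADef fun v => p (v 0) (fun i => v (i + 1))] : DefFun fun v => least fun n => p n v := by
  have h2 : ∀ (ρ : ℕ → ℕ) (t : (ℕ → M.Num) → M.Num) [DefFun t],
      ADef fun v => p (t v) (fun i => v (ρ i)) := fun ρ t _ => ADef.subst ρ t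
  -- The second disjunct describes the default value 0, so that the function is total and definable
  -- with no existence hypothesis.
  refine of_graph (r := fun y v => (p y v ∧ ∀ m, p m v → y ≤ m) ∨
    ((¬ ∃ n, p n v ∧ ∀ m, p m v → n ≤ m) ∧ y = 0)) fun v y => ?_
  by_cases h : ∃ n, p n v ∧ ∀ m, p m v → n ≤ m
  · rw [SOA.L2Structure.least, dif_pos h]
    refine ⟨?_, ?_⟩
    · rintro rfl
      exact Or.inl h.choose_spec
    · rintro (hy | hy)
      · exact le_antisymm (hy.2 _ h.choose_spec.1) (h.choose_spec.2 _ hy.1)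
      · exact (hy.1 h).elim
  · rw [SOA.L2Structure.least, dif_neg h]
    exact ⟨fun hy => Or.inr ⟨h, hy⟩, fun hy => hy.elim (fun hy => (h ⟨y, hy⟩).elim) fun hy => hy.2⟩

/-! ### The ordered field of rational numbers of a model -/

namespace Q

/-- Equality of rational numbers. -/
def Equiv (x y : Q M) : Prop :=
  x.pos * (y.den + 1) + y.neg * (x.den + 1) = y.pos * (x.den + 1) + x.neg * (y.den + 1)

theorem num_succ_ne_zero (a : M.Num) : a + 1 ≠ 0 := (num_zero_lt_succ a).ne'

variable (M) in
/-- Equality of rational numbers, as a setoid. -/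
def setoid : Setoid (Q M) where
  r := Equiv
  iseqv :=
    { refl := fun _ => rfl
      symm := fun h => h.symm
      trans := fun {x y z} h h' => by
        unfold Equiv at *
        refine mul_right_cancel₀ (num_succ_ne_zero y.den) ?_
        linear_combination (z.den + 1) * h + (x.den + 1) * h' }

end Q

variable (M) in
/-- The ordered field of rational numbers of `M`. -/
def Rat : Type u := Quotient (Q.setoid M)

namespace Q

/-- The rational number presented by `q`. -/
def val (q : Q M) : M.Rat := Quotient.mk _ q

theorem val_eq_iff {x y : Q M} : x.val = y.val ↔ Equiv x y := Quotient.eq (r := setoid M)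

end Q

namespace Rat

theorem exists_val (x : M.Rat) : ∃ q : Q M, q.val = x := Quotient.exists_rep x

instance : Zero M.Rat := ⟨(0 : Q M).val⟩
instance : One M.Rat := ⟨(1 : Q M).val⟩

instance : Add M.Rat :=
  ⟨Quotient.map₂ (· + ·) fun a a' h b b' h' => by
    change Q.Equiv _ _ at h h'
    change Q.Equiv ⟨_, _, _⟩ ⟨_, _, _⟩
    unfold Q.Equiv at *
    dsimp only
    linear_combination (b.den + 1) * (b'.den + 1) * h + (a.den + 1) * (a'.den + 1) * h'⟩

instance : Neg M.Rat :=
  ⟨Quotient.map (- ·) fun a a' h => by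
    change Q.Equiv _ _ at h
    change Q.Equiv ⟨_, _, _⟩ ⟨_, _, _⟩
    unfold Q.Equiv at *
    dsimp only
    linear_combination h.symm⟩

/-- The product of two presentations of rational numbers. -/
def mulQ (x y : Q M) : Q M :=
  ⟨x.pos * y.pos + x.neg * y.neg, x.pos * y.neg + x.neg * y.pos, x.den * y.den + x.den + y.den⟩

instance : Mul M.Rat :=
  ⟨Quotient.map₂ mulQ fun a a' h b b' h' => by
    change Q.Equiv _ _ at h h'
    change Q.Equiv _ _
    unfold Q.Equiv mulQ at *
    dsimp only
    have e1 : Q.Equiv (mulQ a b) (mulQ a' b) := by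
      unfold Q.Equiv mulQ
      dsimp only
      linear_combination (b.den + 1) * b.pos * h + (b.den + 1) * b.neg * h.symm
    have e2 : Q.Equiv (mulQ a' b) (mulQ a' b') := by
      unfold Q.Equiv mulQ
      dsimp only
      linear_combination (a'.den + 1) * a'.pos * h' + (a'.den + 1) * a'.neg * h'.symm
    exact (Q.setoid M).trans e1 e2⟩

theorem val_zero : (0 : Q M).val = 0 := rfl
theorem val_one : (1 : Q M).val = 1 := rfl
theorem val_add (x y : Q M) : (x + y).val = x.val + y.val := rfl
theorem val_neg (x : Q M) : (-x).val = -x.val := rfl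
theorem val_mul (x y : Q M) : (mulQ x y).val = x.val * y.val := rfl

theorem Q_zero : (0 : Q M) = ⟨0, 0, 0⟩ := rfl
theorem Q_one : (1 : Q M) = ⟨1, 0, 0⟩ := rfl
theorem Q_add (x y : Q M) : x + y = ⟨x.pos * (y.den + 1) + y.pos * (x.den + 1),
    x.neg * (y.den + 1) + y.neg * (x.den + 1), x.den * y.den + x.den + y.den⟩ := rfl
theorem Q_neg (x : Q M) : -x = ⟨x.neg, x.pos, x.den⟩ := rfl

noncomputable instance : CommRing M.Rat where
  add_assoc a b c := by
    obtain ⟨⟨x, rfl⟩, ⟨y, rfl⟩, ⟨z, rfl⟩⟩ := And.intro (exists_val a) <|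
      And.intro (exists_val b) (exists_val c)
    simp only [← val_add, Q.val_eq_iff, Q.Equiv, Q_add]
    ring
  add_comm a b := by
    obtain ⟨⟨x, rfl⟩, ⟨y, rfl⟩⟩ := And.intro (exists_val a) (exists_val b)
    simp only [← val_add, Q.val_eq_iff, Q.Equiv, Q_add]
    ring
  zero_add a := by
    obtain ⟨x, rfl⟩ := exists_val a
    simp only [← val_zero, ← val_add, Q.val_eq_iff, Q.Equiv, Q_add, Q_zero]
    ring
  add_zero a := by
    obtain ⟨x, rfl⟩ := exists_val a
    simp only [← val_zero, ← val_add, Q.val_eq_iff, Q.Equiv, Q_add, Q_zero]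
    ring
  neg_add_cancel a := by
    obtain ⟨x, rfl⟩ := exists_val a
    simp only [← val_zero, ← val_add, ← val_neg, Q.val_eq_iff, Q.Equiv, Q_add, Q_zero, Q_neg]
    ring
  mul_assoc a b c := by
    obtain ⟨⟨x, rfl⟩, ⟨y, rfl⟩, ⟨z, rfl⟩⟩ := And.intro (exists_val a) <|
      And.intro (exists_val b) (exists_val c)
    simp only [← val_mul, Q.val_eq_iff, Q.Equiv, mulQ]
    ring
  mul_comm a b := by
    obtain ⟨⟨x, rfl⟩, ⟨y, rfl⟩⟩ := And.intro (exists_val a) (exists_val b)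
    simp only [← val_mul, Q.val_eq_iff, Q.Equiv, mulQ]
    ring
  one_mul a := by
    obtain ⟨x, rfl⟩ := exists_val a
    simp only [← val_one, ← val_mul, Q.val_eq_iff, Q.Equiv, mulQ, Q_one]
    ring
  mul_one a := by
    obtain ⟨x, rfl⟩ := exists_val a
    simp only [← val_one, ← val_mul, Q.val_eq_iff, Q.Equiv, mulQ, Q_one]
    ring
  zero_mul a := by
    obtain ⟨x, rfl⟩ := exists_val a
    simp only [← val_zero, ← val_mul, Q.val_eq_iff, Q.Equiv, mulQ, Q_zero]
    ring
  mul_zero a := by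
    obtain ⟨x, rfl⟩ := exists_val a
    simp only [← val_zero, ← val_mul, Q.val_eq_iff, Q.Equiv, mulQ, Q_zero]
    ring
  left_distrib a b c := by
    obtain ⟨⟨x, rfl⟩, ⟨y, rfl⟩, ⟨z, rfl⟩⟩ := And.intro (exists_val a) <|
      And.intro (exists_val b) (exists_val c)
    simp only [← val_mul, ← val_add, Q.val_eq_iff, Q.Equiv, mulQ, Q_add]
    ring
  right_distrib a b c := by
    obtain ⟨⟨x, rfl⟩, ⟨y, rfl⟩, ⟨z, rfl⟩⟩ := And.intro (exists_val a) <|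
      And.intro (exists_val b) (exists_val c)
    simp only [← val_mul, ← val_add, Q.val_eq_iff, Q.Equiv, mulQ, Q_add]
    ring
  nsmul := nsmulRec
  zsmul := zsmulRec

theorem val_eq_zero {x : Q M} : x.val = 0 ↔ x.pos = x.neg := by
  rw [← val_zero, Q.val_eq_iff, Q.Equiv, Q_zero]
  simp

theorem isField : IsField M.Rat where
  exists_pair_ne := ⟨0, 1, fun h => by
    have := val_eq_zero.1 (val_one.trans h.symm)
    exact zero_ne_one this.symm⟩
  mul_comm := mul_comm
  mul_inv_cancel {a} ha := by
    obtain ⟨x, rfl⟩ := exists_val a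
    rw [Ne, val_eq_zero] at ha
    rcases lt_or_gt_of_ne ha with h | h
    · obtain ⟨c, hc⟩ := (num_lt_iff_exists _ _).1 h
      refine ⟨(⟨0, x.den + 1, c⟩ : Q M).val, ?_⟩
      simp only [← val_one, ← val_mul, Q.val_eq_iff, Q.Equiv, mulQ, Q_one, hc]
      ring
    · obtain ⟨c, hc⟩ := (num_lt_iff_exists _ _).1 h
      refine ⟨(⟨x.den + 1, 0, c⟩ : Q M).val, ?_⟩
      simp only [← val_one, ← val_mul, Q.val_eq_iff, Q.Equiv, mulQ, Q_one, hc]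
      ring

noncomputable instance : Field M.Rat := isField.toField

/-- A rational number is positive. -/
def Pos (x : M.Rat) : Prop := ∃ q : Q M, q.val = x ∧ q.neg < q.pos

/-- Positivity is independent of the presentation: cross-multiply by the positive denominators and
cancel. -/
theorem pos_val {q : Q M} : Pos q.val ↔ q.neg < q.pos := by
  refine ⟨fun ⟨p, hp, h⟩ => ?_, fun h => ⟨q, rfl, h⟩⟩
  rw [Q.val_eq_iff, Q.Equiv] at hp
  have h1 := mul_lt_mul_of_pos_right h (num_zero_lt_succ q.den)
  have h2 : q.neg * (p.den + 1) < q.pos * (p.den + 1) := by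
    by_contra! hle
    exact (add_lt_add_of_le_of_lt hle h1).ne (by rw [← hp]; ring)
  exact lt_of_mul_lt_mul_right h2 (num_nonneg _)

theorem Pos.add {x y : M.Rat} (hx : Pos x) (hy : Pos y) : Pos (x + y) := by
  obtain ⟨p, rfl, hp⟩ := hx
  obtain ⟨q, rfl, hq⟩ := hy
  rw [← val_add, pos_val, Q_add]
  exact add_lt_add (mul_lt_mul_of_pos_right hp (num_zero_lt_succ _))
    (mul_lt_mul_of_pos_right hq (num_zero_lt_succ _))

theorem Pos.mul {x y : M.Rat} (hx : Pos x) (hy : Pos y) : Pos (x * y) := by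
  obtain ⟨p, rfl, hp⟩ := hx
  obtain ⟨q, rfl, hq⟩ := hy
  rw [← val_mul, pos_val, mulQ]
  obtain ⟨c, hc⟩ := (num_lt_iff_exists _ _).1 hp
  obtain ⟨d, hd⟩ := (num_lt_iff_exists _ _).1 hq
  refine (num_lt_iff_exists _ _).2 ⟨c * d + c + d, ?_⟩
  rw [hc, hd]
  ring

theorem not_pos_zero : ¬ Pos (0 : M.Rat) := by
  rw [← val_zero, pos_val]
  exact lt_irrefl _

theorem pos_or (x : M.Rat) : Pos x ∨ x = 0 ∨ Pos (-x) := by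
  obtain ⟨q, rfl⟩ := exists_val x
  rw [← val_neg, pos_val, pos_val, val_eq_zero, Q_neg]
  rcases lt_trichotomy q.neg q.pos with h | h | h
  exacts [Or.inl h, Or.inr (Or.inl h.symm), Or.inr (Or.inr h)]

noncomputable instance : LinearOrder M.Rat where
  lt x y := Pos (y - x)
  le x y := ¬ Pos (x - y)
  le_refl x := by rw [sub_self]; exact not_pos_zero
  le_trans x y z h h' hxz := by
    rcases pos_or (y - z) with hb | hb | hb
    · exact h' hb
    · exact h (by rwa [sub_eq_zero.1 hb])
    · exact h (by simpa using hb.add hxz)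
  lt_iff_le_not_ge x y := by
    refine ⟨fun h => ⟨fun h' => not_pos_zero (M := M) ?_, fun h' => h' h⟩, fun h => not_not.1 h.2⟩
    simpa using h.add h'
  le_antisymm x y h h' := by
    rcases pos_or (x - y) with hb | hb | hb
    · exact (h hb).elim
    · exact sub_eq_zero.1 hb
    · exact (h' (by simpa using hb)).elim
  le_total x y := by
    by_contra! h
    exact not_pos_zero (M := M) (by simpa using h.1.add h.2)
  toDecidableLE := Classical.decRel _

theorem lt_iff_pos {x y : M.Rat} : x < y ↔ Pos (y - x) := Iff.rfl

instance : IsStrictOrderedRing M.Rat :=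
  have : IsOrderedAddMonoid M.Rat :=
    ⟨fun a b h c hc => h (by simpa using hc), fun a b h c hc => h (by simpa using hc)⟩
  have : ZeroLEOneClass M.Rat := ⟨fun h => by
    rw [zero_sub, ← val_one, ← val_neg, pos_val] at h
    exact (num_nonneg (1 : M.Num)) h⟩
  IsStrictOrderedRing.of_mul_pos fun a b ha hb => by
    rw [lt_iff_pos, sub_zero] at *
    exact ha.mul hb

theorem val_lt {x y : Q M} : x < y ↔ x.val < y.val := by
  rw [lt_iff_pos, sub_eq_add_neg, ← val_neg, ← val_add, pos_val, Q_add, Q_neg]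
  change x.pos * (y.den + 1) + y.neg * (x.den + 1) <
    y.pos * (x.den + 1) + x.neg * (y.den + 1) ↔ _
  dsimp only
  rw [add_comm (x.pos * _)]

theorem val_le {x y : Q M} : x ≤ y ↔ x.val ≤ y.val := by
  rw [← not_lt, ← val_lt]
  rfl

theorem val_sub (x y : Q M) : (x - y).val = x.val - y.val := by
  rw [sub_eq_add_neg]
  rfl

/-- The embedding of the natural numbers of `M` into its rational numbers. -/
def ofNum : M.Num →+* M.Rat where
  toFun n := (⟨n, 0, 0⟩ : Q M).val
  map_zero' := rfl
  map_one' := rfl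
  map_add' a b := by
    simp only [← val_add, Q.val_eq_iff, Q.Equiv, Q_add]
    ring
  map_mul' a b := by
    simp only [← val_mul, Q.val_eq_iff, Q.Equiv, mulQ]
    ring

theorem ofNum_lt {a b : M.Num} : ofNum a < ofNum b ↔ a < b := by
  change Q.val _ < Q.val _ ↔ _
  rw [← val_lt]
  change a * (0 + 1) + 0 * (0 + 1) < b * (0 + 1) + 0 * (0 + 1) ↔ _
  simp

theorem ofNum_le {a b : M.Num} : ofNum a ≤ ofNum b ↔ a ≤ b := by
  rw [← not_lt, ofNum_lt, not_lt]

theorem ofNum_nonneg (a : M.Num) : 0 ≤ ofNum a := by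
  rw [← map_zero ofNum, ofNum_le]
  exact num_nonneg a

theorem val_eq (q : Q M) : q.val = (ofNum q.pos - ofNum q.neg) / (ofNum q.den + 1) := by
  rw [eq_div_iff (by linarith [ofNum_nonneg q.den] : (0 : M.Rat) < ofNum q.den + 1).ne',
    ← map_one ofNum, ← map_add]
  change q.val * Q.val _ = Q.val _ - Q.val _
  simp only [← val_mul, ← val_sub, Q.val_eq_iff]
  change Q.Equiv (mulQ q ⟨q.den + 1, 0, 0⟩)
    ⟨q.pos * (0 + 1) + 0 * (0 + 1), 0 * (0 + 1) + q.neg * (0 + 1),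
    0 * 0 + 0 + 0⟩
  simp only [Q.Equiv, mulQ]
  ring

end Rat

/-! ### Pairs -/

instance {s t : (ℕ → M.Num) → M.Num} [DefFun s] [DefFun t] : DefFun fun v => pair (s v) (t v) := by
  unfold pair
  infer_instance

instance {s t : (ℕ → M.Num) → M.Num} [DefFun s] [DefFun t] : ADef fun v => s v ∣ t v := by
  simp only [dvd_def]
  infer_instance

/-- The code of a pair lies in [(i + j)², (i + j + 1)²), and these intervals are disjoint for
distinct sums. -/
theorem add_eq_of_pair_eq {i j i' j' : M.Num} (h : pair i j = pair i' j') : ¬ i + j < i' + j' := by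
  intro hlt
  have h1 : i + j + 1 ≤ i' + j' := num_succ_le_iff.2 hlt
  have h2 := mul_le_mul h1 h1 (num_nonneg _) (num_nonneg _)
  have h3 : pair i j < (i + j + 1) * (i + j + 1) := by
    refine (num_lt_iff_exists _ _).2 ⟨i + j + j, ?_⟩
    unfold pair
    ring
  exact (h3.trans_le (h2.trans (le_self_add (b := i')))).ne h

theorem pair_inj {i j i' j' : M.Num} : pair i j = pair i' j' ↔ i = i' ∧ j = j' := by
  refine ⟨fun h => ?_, fun ⟨h, h'⟩ => by rw [h, h']⟩
  have hs : i + j = i' + j' :=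
    le_antisymm (not_lt.1 (add_eq_of_pair_eq h.symm)) (not_lt.1 (add_eq_of_pair_eq h))
  have hi : i = i' := by
    unfold pair at h
    rw [hs] at h
    exact add_left_cancel h
  subst hi
  exact ⟨rfl, add_left_cancel hs⟩

theorem Q.code_inj {p q : Q M} : p.code = q.code ↔ p = q := by
  simp only [Q.code, pair_inj, Q.ext_iff, and_assoc]

/-! ### Codes of finite sets -/

/-- Relative primality of natural numbers of a model. -/
def Cop (x m : M.Num) : Prop := ∃ u v, u * x = v * m + 1

instance {s t : (ℕ → M.Num) → M.Num} [DefFun s] [DefFun t] : ADef fun v => Cop (s v) (t v) := by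
  unfold Cop
  infer_instance

theorem Cop.mul {x y m : M.Num} : Cop x m → Cop y m → Cop (x * y) m := by
  rintro ⟨u, v, h⟩ ⟨u', v', h'⟩
  refine ⟨u * u', v * m * v' + v + v', ?_⟩
  rw [show u * u' * (x * y) = (u * x) * (u' * y) by ring, h, h']
  ring

theorem Cop.not_dvd {x m : M.Num} (h : Cop x m) (hm : 1 < m) : ¬ m ∣ x := by
  rintro ⟨w, rfl⟩
  obtain ⟨u, v, h⟩ := h
  have h1 : v * m < u * w * m := by
    rw [show u * w * m = u * (m * w) by ring, h]
    exact num_lt_succ_iff.2 le_rfl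
  have h2 : (v + 1) * m ≤ u * w * m :=
    mul_le_mul_of_nonneg_right (num_succ_le_iff.2 (lt_of_mul_lt_mul_right h1 (num_nonneg _)))
      (num_nonneg _)
  rw [show u * w * m = u * (m * w) by ring, h, add_mul, one_mul] at h2
  exact (le_of_add_le_add_left h2).not_gt hm

/-- One has (j + 1)(1 + (i + 1)d) − (i + 1)(1 + (j + 1)d) = j − i, which divides d, and d is
invertible modulo either modulus. The witnesses are the resulting Bézout coefficients, arranged
without subtraction; as `Cop` is not symmetric in form, both orders are treated. -/
theorem cop_moduli {i j d : M.Num} (hij : i < j) (hd : 0 < d) (h : ∀ g, 0 < g → g ≤ j → g ∣ d) :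
    Cop (1 + (i + 1) * d) (1 + (j + 1) * d) ∧ Cop (1 + (j + 1) * d) (1 + (i + 1) * d) := by
  obtain ⟨g, rfl⟩ := (num_lt_iff_exists _ _).1 hij
  obtain ⟨e, rfl⟩ := h (g + 1) (num_zero_lt_succ g) le_add_self
  obtain ⟨f, rfl⟩ : ∃ f, e = f + 1 := (num_eq_zero_or_succ e).resolve_left (by
    rintro rfl
    simp at hd)
  refine ⟨⟨1 + (i + 1) * (i + (g + 1) + 1) ^ 2 * (f + 1) * ((g + 1) * (f + 1)),
    (i + 1) * ((g + 1) * (f + 1)) * (1 + (i + 1) * (i + (g + 1) + 1) * (f + 1)), by ring⟩,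
    ⟨(i + 1) ^ 2 * (f + 1), (i + 1) * (i + (g + 1) + 1) * f + (i + 1) * (i + (g + 1)) + i, ?_⟩⟩
  ring

theorem exists_common_multiple (k : M.Num) : ∃ d, 0 < d ∧ ∀ g, 0 < g → g ≤ k → g ∣ d := by
  refine induct (p := fun k => ∃ d, 0 < d ∧ ∀ g, 0 < g → g ≤ k → g ∣ d) ?_ (fun k ih => ?_) k
  · exact ⟨1, by simp, fun g h h' => ((h.trans_le h').ne rfl).elim⟩
  · obtain ⟨d, hd, h⟩ := ih
    refine ⟨d * (k + 1), mul_pos hd (num_zero_lt_succ k), fun g h0 hg => ?_⟩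
    rcases hg.lt_or_eq with hg | rfl
    · exact (h g h0 (num_lt_succ_iff.1 hg)).mul_right _
    · exact dvd_mul_left _ _

/-- `i` belongs to the finite set with code `e`. -/
def InCode (i e : M.Num) : Prop :=
  ∃ k d c, e = pair k (pair d c) ∧ i < k ∧ 1 + (i + 1) * d ∣ c

instance {s t : (ℕ → M.Num) → M.Num} [DefFun s] [DefFun t] : ADef fun v => InCode (s v) (t v) := by
  unfold InCode
  infer_instance

theorem InCode.lt {i e : M.Num} : InCode i e → i < e := by
  rintro ⟨k, d, c, rfl, hi, -⟩
  exact hi.trans_le le_add_self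

/-- Gödel's device: the number c is the product of the moduli 1 + (i + 1)d over the i < k in X.
Coprimality to the remaining moduli is kept along the induction as a Bézout relation, so no theory
of primes is needed. -/
theorem exists_code {X : Set M.Num} (hX : X ∈ M.sets) (k : M.Num) :
    ∃ e, ∀ i, InCode i e ↔ i < k ∧ i ∈ X := by
  have : Fact (X ∈ M.sets) := ⟨hX⟩
  obtain ⟨d, hd, hdvd⟩ := exists_common_multiple k
  have hcop : ∀ i j, i < k → j < k → i ≠ j → Cop (1 + (i + 1) * d) (1 + (j + 1) * d) := by
    intro i j hi hj hij
    rcases lt_or_gt_of_ne hij with h | h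
    · exact (cop_moduli h hd fun g h0 hg => hdvd g h0 (hg.trans hj.le)).1
    · exact (cop_moduli h hd fun g h0 hg => hdvd g h0 (hg.trans hi.le)).2
  obtain ⟨c, hc⟩ : ∃ c, ∀ i, i < k → (i < k → i ∈ X → 1 + (i + 1) * d ∣ c) ∧
      (i ∉ X → Cop c (1 + (i + 1) * d)) := by
    refine induct (p := fun l => l ≤ k → ∃ c, ∀ i, i < k → (i < l → i ∈ X → 1 + (i + 1) * d ∣ c) ∧
      (i ∉ X → Cop c (1 + (i + 1) * d))) (fun _ => ?_) (fun l ih hl => ?_) k le_rfl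
    · exact ⟨1, fun i _ => ⟨fun h => (hM.out.not_lt_zero _ h).elim, fun _ => ⟨1, 0, by ring⟩⟩⟩
    · have hlk := num_succ_le_iff.1 hl
      obtain ⟨c, hc⟩ := ih hlk.le
      by_cases hlX : l ∈ X
      · refine ⟨c * (1 + (l + 1) * d), fun i hi => ⟨fun hil hiX => ?_, fun hiX => ?_⟩⟩
        · rcases (num_lt_succ_iff.1 hil).lt_or_eq with h | rfl
          · exact ((hc i hi).1 h hiX).mul_right _
          · exact dvd_mul_left _ _
        · exact ((hc i hi).2 hiX).mul (hcop l i hlk hi fun h => hiX (h ▸ hlX))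
      · refine ⟨c, fun i hi => ⟨fun hil hiX => ?_, (hc i hi).2⟩⟩
        rcases (num_lt_succ_iff.1 hil).lt_or_eq with h | rfl
        · exact (hc i hi).1 h hiX
        · exact (hlX hiX).elim
  refine ⟨pair k (pair d c), fun i => ⟨?_, fun ⟨hi, hiX⟩ => ⟨k, d, c, rfl, hi, (hc i hi).1 hi hiX⟩⟩⟩
  rintro ⟨k', d', c', he, hi, hdv⟩
  rw [pair_inj, pair_inj] at he
  obtain ⟨rfl, rfl, rfl⟩ := he
  refine ⟨hi, not_not.1 fun hiX => ((hc i hi).2 hiX).not_dvd ?_ hdv⟩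
  exact lt_add_of_pos_right _ (mul_pos (num_zero_lt_succ i) hd)

/-! ### Primitive recursion -/

/-- The finite set with code `e` is a computation of the values at `0, …, n` of the function
defined by recursion from `a` and `H`, and the value at `n` is `y`. -/
def IsComputation (a : M.Num) (H : M.Num → M.Num → M.Num) (e n y : M.Num) : Prop :=
  (∀ y, InCode (pair 0 y) e → y = a) ∧
  (∀ i y, InCode (pair (i + 1) y) e → ∃ y', InCode (pair i y') e ∧ y = H i y') ∧
  InCode (pair n y) e

/-- The function defined by recursion from `a` and `H`. -/
noncomputable def recN (a : M.Num) (H : M.Num → M.Num → M.Num) (n : M.Num) : M.Num :=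
  least fun y => ∃ e, IsComputation a H e n y

theorem DefFun.subst₂ {H : M.Num → M.Num → (ℕ → M.Num) → M.Num}
    [hH : DefFun fun v => H (v 0) (v 1) (fun i => v (i + 2))] (ρ : ℕ → ℕ)
    (s t : (ℕ → M.Num) → M.Num) [DefFun s] [DefFun t] :
    DefFun fun v => H (s v) (t v) (fun i => v (ρ i)) := by
  have h := hH.graph
  have h2 : ADef fun v => v 2 = H (v 1) (v 0) (fun i => v (ρ i + 3)) :=
    h.rename (fun i => match i with | 0 => 2 | 1 => 1 | 2 => 0 | i + 3 => ρ i + 3)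
  exact of_graph (r := fun y v => ∃ a, a = s v ∧ ∃ b, b = t v ∧ y = H a b (fun i => v (ρ i)))
    (by simp)

instance DefFun.recN {a : (ℕ → M.Num) → M.Num} {H : M.Num → M.Num → (ℕ → M.Num) → M.Num}
    {n : (ℕ → M.Num) → M.Num} [DefFun a] [DefFun n]
    [DefFun fun v => H (v 0) (v 1) (fun i => v (i + 2))] :
    DefFun fun v => recN (a v) (fun i y => H i y v) (n v) := by
  have h : ∀ (ρ : ℕ → ℕ) (s t : (ℕ → M.Num) → M.Num) [DefFun s] [DefFun t],
    DefFun fun v => H (s v) (t v) (fun i => v (ρ i)) := fun ρ s t _ _ => DefFun.subst₂ ρ s t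
  unfold SOA.L2Structure.recN IsComputation
  infer_instance

section

variable {a : M.Num} {H : M.Num → M.Num → M.Num}

theorem IsComputation.unique {e e' n y y' : M.Num}
    (h : IsComputation a H e n y) (h' : IsComputation a H e' n y') : y = y' := by
  refine induct (p := fun n => ∀ y y', InCode (pair n y) e → InCode (pair n y') e' → y = y')
    (fun y y' hy hy' => ?_) (fun n ih y y' hy hy' => ?_) n y y' h.2.2 h'.2.2
  · rw [h.1 _ hy, h'.1 _ hy']
  · obtain ⟨z, hz, rfl⟩ := h.2.1 _ _ hy
    obtain ⟨z', hz', rfl⟩ := h'.2.1 _ _ hy'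
    rw [ih z z' hz hz']

theorem isComputation_zero : ∃ e, IsComputation a H e 0 a := by
  obtain ⟨e, he⟩ := exists_code (setOf_mem fun z => z = pair 0 a) (pair 0 a + 1)
  simp only [Set.mem_ofPred_eq] at he
  refine ⟨e, fun y hy => (pair_inj.1 ((he _).1 hy).2).2, fun i y hy => ?_,
    (he _).2 ⟨num_lt_succ_iff.2 le_rfl, rfl⟩⟩
  exact (hM.out.succ_ne_zero i (pair_inj.1 ((he _).1 hy).2).1).elim

theorem IsComputation.succ {e n y : M.Num} (h : IsComputation a H e n y) :
    ∃ e, IsComputation a H e (n + 1) (H n y) := by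
  obtain ⟨e', he⟩ := exists_code (setOf_mem fun z => InCode z e ∨ z = pair (n + 1) (H n y))
    (e + pair (n + 1) (H n y) + 1)
  have he : ∀ i, InCode i e' ↔ InCode i e ∨ i = pair (n + 1) (H n y) := fun i => by
    rw [he]
    refine and_iff_right_of_imp ?_
    rintro (h | rfl)
    · exact num_lt_succ_iff.2 (h.lt.le.trans le_self_add)
    · exact num_lt_succ_iff.2 le_add_self
  refine ⟨e', fun z hz => ?_, fun i z hz => ?_, (he _).2 (Or.inr rfl)⟩
  · rcases (he _).1 hz with hz | hz
    · exact h.1 z hz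
    · exact (hM.out.succ_ne_zero n (pair_inj.1 hz).1.symm).elim
  · rcases (he _).1 hz with hz | hz
    · obtain ⟨y', hy', rfl⟩ := h.2.1 _ _ hz
      exact ⟨y', (he _).2 (Or.inl hy'), rfl⟩
    · obtain ⟨hi, rfl⟩ := pair_inj.1 hz
      obtain rfl := hM.out.succ_inj _ _ hi
      exact ⟨y, (he _).2 (Or.inl h.2.2), rfl⟩

variable [hH : DefFun fun v => H (v 0) (v 1)]

theorem adef_isComputation {s t r : (ℕ → M.Num) → M.Num} [DefFun s] [DefFun t] [DefFun r] :
    ADef fun v => IsComputation a H (s v) (t v) (r v) := by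
  have h : ∀ (s t : (ℕ → M.Num) → M.Num) [DefFun s] [DefFun t],
    DefFun fun v => H (s v) (t v) := fun s t _ _ =>
      DefFun.subst₂ (H := fun i y _ => H i y) (fun i => i) s t
  unfold IsComputation
  infer_instance

/-- Computations are coded by numbers, so their existence is an arithmetical statement and can be
proved by induction. -/
theorem exists_isComputation (n : M.Num) : ∃ y e, IsComputation a H e n y :=
  have := @adef_isComputation M hM a H hH
  induct (p := fun n => ∃ y e, IsComputation a H e n y) ⟨a, isComputation_zero⟩
    (fun _ ⟨_, _, h⟩ => ⟨_, h.succ⟩) n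

theorem exists_isComputation_recN (n : M.Num) : ∃ e, IsComputation a H e n (recN a H n) :=
  have := @adef_isComputation M hM a H hH
  least_spec (p := fun y => ∃ e, IsComputation a H e n y) (exists_isComputation n)

theorem recN_zero : recN a H 0 = a := by
  obtain ⟨e, h⟩ := exists_isComputation_recN (a := a) (H := H) 0
  obtain ⟨e', h'⟩ := isComputation_zero (a := a) (H := H)
  exact h.unique h'

theorem recN_succ (n : M.Num) : recN a H (n + 1) = H n (recN a H n) := by
  obtain ⟨e, h⟩ := exists_isComputation_recN (a := a) (H := H) n
  obtain ⟨e', h'⟩ := h.succ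
  obtain ⟨e'', h''⟩ := exists_isComputation_recN (a := a) (H := H) (n + 1)
  exact h''.unique h'

end

/-! ### Powers of two -/

/-- The power `2ⁿ`. -/
noncomputable def pow2 (n : M.Num) : M.Num := recN 1 (fun _ y => y + y) n

instance {s : (ℕ → M.Num) → M.Num} [DefFun s] : DefFun fun v => pow2 (s v) := by
  unfold pow2
  infer_instance

theorem pow2_zero : pow2 (0 : M.Num) = 1 := recN_zero

theorem pow2_succ (n : M.Num) : pow2 (n + 1) = pow2 n + pow2 n := recN_succ n

theorem pow2_pos (n : M.Num) : 0 < pow2 n :=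
  induct (p := fun n => 0 < pow2 n) (by simp [pow2_zero])
    (fun n ih => by rw [pow2_succ]; exact add_pos ih ih) n

theorem pow2_add (m n : M.Num) : pow2 (m + n) = pow2 m * pow2 n :=
  induct (p := fun n => pow2 (m + n) = pow2 m * pow2 n) (by simp [pow2_zero])
    (fun n ih => by rw [← add_assoc, pow2_succ, ih, pow2_succ, mul_add]) n

theorem lt_pow2 (n : M.Num) : n < pow2 n :=
  induct (p := fun n => n < pow2 n) (by simp [pow2_zero])
    (fun n ih => by
      rw [pow2_succ]
      exact add_lt_add_of_lt_of_le ih (by simpa using num_succ_le_iff.2 (pow2_pos n))) n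

/-- This removes the set quantifier from `IsPow2`, making 2⁻ᵏ, and with it the relations on reals,
arithmetical. Any admissible F contains the graph of `pow2` by induction, and that graph is itself a
set of the model. -/
theorem isPow2_iff {k p : M.Num} : IsPow2 k p ↔ p = pow2 k := by
  constructor
  · rintro ⟨F, hF, hu, h0, hs, hk⟩
    have : Fact (F ∈ M.sets) := ⟨hF⟩
    have h : pair k (pow2 k) ∈ F :=
      induct (p := fun k => pair k (pow2 k) ∈ F) (by rwa [pow2_zero])
        (fun n ih => by rw [pow2_succ]; exact hs _ _ ih) k
    exact (hu k).unique hk h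
  · rintro rfl
    refine ⟨{z | ∃ i, z = pair i (pow2 i)}, setOf_mem _, fun i => ?_, ⟨0, by rw [pow2_zero]⟩, ?_,
      ⟨k, rfl⟩⟩
    · refine ⟨pow2 i, ⟨i, rfl⟩, ?_⟩
      rintro y ⟨j, hj⟩
      obtain ⟨rfl, rfl⟩ := pair_inj.1 hj
      rfl
    · rintro i y ⟨j, hj⟩
      obtain ⟨rfl, rfl⟩ := pair_inj.1 hj
      exact ⟨i + 1, by rw [pow2_succ]⟩

instance {s t : (ℕ → M.Num) → M.Num} [DefFun s] [DefFun t] : ADef fun v => IsPow2 (s v) (t v) :=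
  ADef.congr fun _ => isPow2_iff

/-- The predecessor. -/
noncomputable def pred (n : M.Num) : M.Num := least fun m => n ≤ m + 1

instance {s : (ℕ → M.Num) → M.Num} [DefFun s] : DefFun fun v => pred (s v) := by
  unfold pred
  infer_instance

theorem pred_succ (n : M.Num) : pred (n + 1) = n :=
  le_antisymm (least_le (p := fun m => n + 1 ≤ m + 1) le_rfl)
    (le_of_add_le_add_right (least_spec (p := fun m => n + 1 ≤ m + 1) ⟨n, le_rfl⟩))

theorem pred_add_one {n : M.Num} (h : 0 < n) : pred n + 1 = n := by
  obtain ⟨c, rfl⟩ := (num_lt_iff_exists _ _).1 h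
  rw [zero_add, pred_succ]

/-- The rational number `2⁻ᵏ`. -/
noncomputable def hp (k : M.Num) : M.Rat := 1 / Rat.ofNum (pow2 k)

theorem ofNum_pow2_pos (k : M.Num) : 0 < Rat.ofNum (pow2 k) := by
  rw [← map_zero Rat.ofNum, Rat.ofNum_lt]
  exact pow2_pos k

theorem hp_pos (k : M.Num) : 0 < hp k := one_div_pos.2 (ofNum_pow2_pos k)

theorem hp_zero : hp (0 : M.Num) = 1 := by simp [hp, pow2_zero]

theorem hp_succ (k : M.Num) : hp (k + 1) = hp k / 2 := by
  have := ofNum_pow2_pos k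
  rw [hp, hp, pow2_succ, map_add]
  field_simp
  norm_num

theorem hp_add_le (k m : M.Num) : hp (k + m) ≤ hp k := by
  refine one_div_le_one_div_of_le (ofNum_pow2_pos k) (Rat.ofNum_le.2 ?_)
  rw [pow2_add]
  exact le_mul_of_one_le_right (num_nonneg _) (by simpa using num_succ_le_iff.2 (pow2_pos m))

theorem hp_le {k l : M.Num} (h : k ≤ l) : hp l ≤ hp k := by
  obtain ⟨m, rfl⟩ := exists_add_of_le h
  exact hp_add_le k m

theorem hp_lt {k l : M.Num} (h : k < l) : hp l < hp k := by
  have h1 := hp_le (num_succ_le_iff.2 h)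
  have h2 := hp_pos k
  rw [hp_succ] at h1
  linarith

/-- A positive rational with denominator d is at least 1/d, and d < 2ᵈ. The exponent may be
nonstandard, so no Archimedean property in the external sense is involved. -/
theorem exists_hp_lt {x : M.Rat} (hx : 0 < x) : ∃ k, hp k < x := by
  obtain ⟨q, rfl⟩ := Rat.exists_val x
  refine ⟨q.den + 1, ?_⟩
  rw [Rat.val_eq] at hx ⊢
  have h1 : 0 < Rat.ofNum q.den + 1 := by linarith [Rat.ofNum_nonneg q.den]
  have h2 : 1 ≤ Rat.ofNum q.pos - Rat.ofNum q.neg := by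
    have h : Rat.ofNum q.neg < Rat.ofNum q.pos := by
      have := (div_pos_iff_of_pos_right h1).1 hx
      linarith
    have := Rat.ofNum_le.2 (num_succ_le_iff.2 (Rat.ofNum_lt.1 h))
    rw [map_add, map_one] at this
    linarith
  have h3 : Rat.ofNum q.den + 1 < Rat.ofNum (pow2 (q.den + 1)) := by
    rw [← map_one Rat.ofNum, ← map_add, Rat.ofNum_lt]
    exact lt_pow2 _
  exact (one_div_lt_one_div_of_lt h1 h3).trans_le (div_le_div_of_nonneg_right h2 h1.le)

namespace Q

/-- The rational number `b / 2ˡ`. -/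
noncomputable def dyadic (l b : M.Num) : Q M := ⟨b, 0, pred (pow2 l)⟩

theorem val_dyadic (l b : M.Num) : (dyadic l b).val = Rat.ofNum b * hp l := by
  rw [Rat.val_eq, dyadic]
  simp only [map_zero, sub_zero]
  rw [← map_one Rat.ofNum, ← map_add, pred_add_one (pow2_pos l), hp, mul_one_div]

theorem isHalfPow_iff {k : M.Num} {e : Q M} : IsHalfPow k e ↔ e = dyadic k 1 := by
  rw [IsHalfPow, isPow2_iff, dyadic, Q.ext_iff]
  refine and_congr_right fun _ => and_congr_right fun _ => ⟨fun h => ?_, fun h => ?_⟩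
  · rw [← h, pred_succ]
  · rw [h, pred_add_one (pow2_pos k)]

theorem val_half (k : M.Num) : (dyadic k 1).val = hp k := by
  rw [val_dyadic, map_one, one_mul]

theorem IsHalfPow.val {k : M.Num} {e : Q M} (h : IsHalfPow k e) : e.val = hp k := by
  rw [isHalfPow_iff.1 h, val_half]

end Q

/-! ### Binary strings -/

/-- The string with number `b` and length `l` is an initial segment of the string with number `c`
and length `L`. -/
def Pre (l b L c : M.Num) : Prop := ∃ m r, L = l + m ∧ r < pow2 m ∧ c = b * pow2 m + r

instance {l b L c : (ℕ → M.Num) → M.Num} [DefFun l] [DefFun b] [DefFun L] [DefFun c] :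
    ADef fun v => Pre (l v) (b v) (L v) (c v) := by
  unfold Pre
  infer_instance

theorem Pre.le {l b L c : M.Num} : Pre l b L c → l ≤ L := by
  rintro ⟨m, r, rfl, -, -⟩
  exact le_self_add

theorem Pre.refl (l b : M.Num) : Pre l b l b :=
  ⟨0, 0, by simp, pow2_pos 0, by simp [pow2_zero]⟩

theorem Pre.trans {l b l' b' L c : M.Num} : Pre l b l' b' → Pre l' b' L c → Pre l b L c := by
  rintro ⟨m, r, rfl, hr, rfl⟩ ⟨n, s, rfl, hs, rfl⟩
  refine ⟨m + n, r * pow2 n + s, add_assoc _ _ _, ?_, by rw [pow2_add]; ring⟩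
  calc r * pow2 n + s < (r + 1) * pow2 n := by
        rw [add_mul, one_mul]
        exact add_lt_add_of_le_of_lt le_rfl hs
    _ ≤ pow2 (m + n) := by
        rw [pow2_add]
        exact mul_le_mul_of_nonneg_right (num_succ_le_iff.2 hr) (num_nonneg _)

theorem le_of_mul_add_eq {b b' p r r' : M.Num} (hr : r < p)
    (h : b * p + r = b' * p + r') : b' ≤ b := by
  by_contra! hb
  have h1 : (b + 1) * p ≤ b' * p :=
    mul_le_mul_of_nonneg_right (num_succ_le_iff.2 hb) (num_nonneg _)
  have h2 : b * p + r < (b + 1) * p := by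
    rw [add_mul, one_mul]
    exact add_lt_add_of_le_of_lt le_rfl hr
  exact (h2.trans_le (h1.trans le_self_add)).ne h

theorem Pre.unique {l b b' L c : M.Num} : Pre l b L c → Pre l b' L c → b = b' := by
  rintro ⟨m, r, rfl, hr, rfl⟩ ⟨m', r', hm, hr', h⟩
  obtain rfl := add_left_cancel hm
  exact le_antisymm (le_of_mul_add_eq hr' h.symm) (le_of_mul_add_eq hr h)

theorem exists_pre {l L : M.Num} (h : l ≤ L) (c : M.Num) : ∃ b, Pre l b L c := by
  obtain ⟨m, rfl⟩ := exists_add_of_le h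
  suffices h : ∃ b r, r < pow2 m ∧ c = b * pow2 m + r by
    obtain ⟨b, r, h⟩ := h
    exact ⟨b, m, r, rfl, h⟩
  refine induct (p := fun c => ∃ b r, r < pow2 m ∧ c = b * pow2 m + r)
    ⟨0, 0, pow2_pos m, by simp⟩ ?_ c
  rintro _ ⟨b, r, hr, rfl⟩
  rcases (num_succ_le_iff.2 hr).lt_or_eq with h | h
  · exact ⟨b, r + 1, h, add_assoc _ _ _⟩
  · exact ⟨b + 1, 0, pow2_pos m, by rw [add_assoc, h]; ring⟩

theorem Pre.between {l b l' L c : M.Num} (h : Pre l b L c) (hl : l ≤ l') (hL : l' ≤ L) :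
    ∃ b', Pre l b l' b' ∧ Pre l' b' L c := by
  obtain ⟨b', h'⟩ := exists_pre hL c
  obtain ⟨b'', h''⟩ := exists_pre hl b'
  obtain rfl := h.unique (h''.trans h')
  exact ⟨b', h'', h'⟩

theorem pre_zero_iff {L c : M.Num} : Pre 0 0 L c ↔ c < pow2 L := by
  constructor
  · rintro ⟨m, r, rfl, hr, rfl⟩
    simpa using hr
  · exact fun h => ⟨L, c, by simp, h, by simp⟩

theorem Pre.of_succ {l b c : M.Num} : Pre l b (l + 1) c → c = b + b ∨ c = b + b + 1 := by
  rintro ⟨m, r, hm, hr, rfl⟩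
  obtain rfl := add_left_cancel hm
  rw [← zero_add (1 : M.Num), pow2_succ, pow2_zero] at hr ⊢
  rcases (num_lt_succ_iff.1 hr).lt_or_eq with h | rfl
  · have h0 : r = 0 := le_antisymm (num_lt_succ_iff.1 (by simpa using h)) (num_nonneg r)
    left
    rw [h0]
    ring
  · right
    ring

theorem pre_succ_left (l b : M.Num) : Pre l b (l + 1) (b + b) :=
  ⟨1, 0, rfl, pow2_pos 1, by rw [← zero_add (1 : M.Num), pow2_succ, pow2_zero]; ring⟩

theorem pre_succ_right (l b : M.Num) : Pre l b (l + 1) (b + b + 1) :=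
  ⟨1, 1, rfl, by rw [← zero_add (1 : M.Num), pow2_succ, pow2_zero]; simp,
    by rw [← zero_add (1 : M.Num), pow2_succ, pow2_zero]; ring⟩

open Classical in
/-- The number of the initial segment of length `l` of the point `z` of Cantor space. -/
noncomputable def restr (z : Set M.Num) (l : M.Num) : M.Num :=
  recN 0 (fun i y => if i ∈ z then y + y + 1 else y + y) l

theorem ADef.subst₂ {B : M.Num → M.Num → (ℕ → M.Num) → Prop}
    [hB : ADef fun v => B (v 0) (v 1) (fun i => v (i + 2))] (ρ : ℕ → ℕ)
    (s t : (ℕ → M.Num) → M.Num) [DefFun s] [DefFun t] :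
    ADef fun v => B (s v) (t v) (fun i => v (ρ i)) := by
  have : ADef fun v => B (v 1) (v 0) (fun i => v (ρ i + 2)) :=
    hB.rename (fun i => match i with | 0 => 1 | 1 => 0 | i + 2 => ρ i + 2)
  exact ADef.congr (q := fun v => ∃ a, a = s v ∧ ∃ b, b = t v ∧ B a b (fun i => v (ρ i)))
    (by simp)

instance {z : (ℕ → M.Num) → Set M.Num} {s : (ℕ → M.Num) → M.Num} [DefFun s]
    [hz : ADef fun v => v 0 ∈ z (fun i => v (i + 1))] : DefFun fun v => restr (z v) (s v) := by
  have : ADef fun v => v 0 ∈ z (fun i => v (i + 2)) :=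
    ADef.subst (p := fun i v => i ∈ z v) (· + 2) (fun v => v 0)
  unfold restr
  infer_instance

section

variable {z : Set M.Num} [hz : Fact (z ∈ M.sets)]

theorem restr_zero : restr z 0 = 0 := recN_zero

open Classical in
theorem restr_succ (l : M.Num) :
    restr z (l + 1) = if l ∈ z then restr z l + restr z l + 1 else restr z l + restr z l :=
  recN_succ l

theorem pre_restr {l L : M.Num} (h : l ≤ L) : Pre l (restr z l) L (restr z L) := by
  obtain ⟨m, rfl⟩ := exists_add_of_le h
  refine induct (p := fun m => Pre l (restr z l) (l + m) (restr z (l + m))) ?_ (fun m ih => ?_) m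
  · simpa using Pre.refl _ _
  · rw [← add_assoc, restr_succ]
    split_ifs
    · exact ih.trans (pre_succ_right _ _)
    · exact ih.trans (pre_succ_left _ _)

end

/-! ### Weak König's lemma -/

/-- No initial segment of the string `c` of length `L` lies in `B`. -/
def Avoids (B : M.Num → M.Num → Prop) (L c : M.Num) : Prop := ∀ l b, Pre l b L c → ¬ B l b

/-- The string `b` of length `l` has arbitrarily long extensions that avoid `B`. -/
def Extendible (B : M.Num → M.Num → Prop) (l b : M.Num) : Prop :=
  ∀ L, l ≤ L → ∃ c, Pre l b L c ∧ Avoids B L c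

open Classical in
/-- The initial segments of the leftmost branch that avoids `B`. -/
noncomputable def path (B : M.Num → M.Num → Prop) (l : M.Num) : M.Num :=
  recN 0 (fun l b => if Extendible B (l + 1) (b + b) then b + b else b + b + 1) l

/-- The leftmost branch that avoids `B`. -/
def branch (B : M.Num → M.Num → Prop) : Set M.Num :=
  {i | ¬ Extendible B (i + 1) (path B i + path B i)}

section

variable {B : M.Num → M.Num → (ℕ → M.Num) → Prop} {s t : (ℕ → M.Num) → M.Num}
  [hB : ADef fun v => B (v 0) (v 1) (fun i => v (i + 2))] [DefFun s] [DefFun t]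

instance : ADef fun v => Avoids (fun l b => B l b v) (s v) (t v) := by
  have h : ∀ (ρ : ℕ → ℕ) (s t : (ℕ → M.Num) → M.Num) [DefFun s] [DefFun t],
    ADef fun v => B (s v) (t v) (fun i => v (ρ i)) := fun ρ s t _ _ => ADef.subst₂ ρ s t
  unfold Avoids
  infer_instance

instance : ADef fun v => Extendible (fun l b => B l b v) (s v) (t v) := by
  have h : ∀ (ρ : ℕ → ℕ) (s t : (ℕ → M.Num) → M.Num) [DefFun s] [DefFun t],
    ADef fun v => B (s v) (t v) (fun i => v (ρ i)) := fun ρ s t _ _ => ADef.subst₂ ρ s t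
  unfold Extendible
  infer_instance

instance : DefFun fun v => path (fun l b => B l b v) (s v) := by
  have h : ∀ (ρ : ℕ → ℕ) (s t : (ℕ → M.Num) → M.Num) [DefFun s] [DefFun t],
    ADef fun v => B (s v) (t v) (fun i => v (ρ i)) := fun ρ s t _ _ => ADef.subst₂ ρ s t
  unfold path
  infer_instance

instance : ADef fun v => s v ∈ branch (fun l b => B l b v) := by
  unfold branch
  simp only [Set.mem_ofPred_eq]
  infer_instance

end

section

variable {B : M.Num → M.Num → Prop} [hB : ADef fun v => B (v 0) (v 1)]

theorem branch_mem_sets : branch B ∈ M.sets := setOf_mem fun i => i ∈ branch B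

theorem Avoids.of_pre {l b L c : M.Num} (h : Avoids B L c) (h' : Pre l b L c) : Avoids B l b :=
  fun _ _ h'' => h _ _ (h''.trans h')

/-- If the two children fail at lengths L and L', an avoiding extension of length L + L' passes
through one of them, and cutting it at the corresponding length contradicts that failure. -/
theorem Extendible.succ {l b : M.Num} (h : Extendible B l b) :
    Extendible B (l + 1) (b + b) ∨ Extendible B (l + 1) (b + b + 1) := by
  by_contra! hc
  simp only [Extendible, not_forall] at hc
  obtain ⟨⟨L, hL, h1⟩, ⟨L', hL', h2⟩⟩ := hc
  have hl : l + 1 ≤ L + L' := hL.trans le_self_add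
  obtain ⟨c, hc, hcB⟩ := h (L + L') (le_self_add.trans hl)
  obtain ⟨b', hb, hb'⟩ := hc.between le_self_add hl
  rcases hb.of_succ with rfl | rfl
  · obtain ⟨c', h3, h4⟩ := hb'.between hL le_self_add
    exact h1 ⟨c', h3, hcB.of_pre h4⟩
  · obtain ⟨c', h3, h4⟩ := hb'.between hL' le_add_self
    exact h2 ⟨c', h3, hcB.of_pre h4⟩

open Classical in
theorem path_succ (l : M.Num) : path B (l + 1) =
    if Extendible B (l + 1) (path B l + path B l) then path B l + path B l
    else path B l + path B l + 1 :=
  recN_succ l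

theorem restr_branch (l : M.Num) : restr (branch B) l = path B l := by
  have : Fact (branch B ∈ M.sets) := ⟨branch_mem_sets⟩
  refine induct (p := fun l => restr (branch B) l = path B l) ?_ (fun l ih => ?_) l
  · rw [restr_zero]
    exact recN_zero.symm
  · rw [restr_succ, path_succ, ih]
    by_cases h : Extendible B (l + 1) (path B l + path B l)
    · rw [if_pos h, if_neg fun h' => h' h]
    · rw [if_neg h, if_pos (show l ∈ branch B from h)]

/-- Extendibility propagates along the leftmost path; taken at length l itself, it says that the
initial segment is not in B. -/
theorem not_restr_branch (h : Extendible B 0 0) (l : M.Num) : ¬ B l (restr (branch B) l) := by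
  rw [restr_branch]
  have h : Extendible B l (path B l) := by
    refine induct (p := fun l => Extendible B l (path B l)) ?_ (fun l ih => ?_) l
    · rwa [path, recN_zero]
    · rw [path_succ]
      split_ifs with h'
      · exact h'
      · exact ih.succ.resolve_left h'
  obtain ⟨c, hc, hcB⟩ := h l le_rfl
  exact hcB _ _ hc

theorem extendible_of_avoids {z : Set M.Num} (hz : z ∈ M.sets) (h : ∀ l, ¬ B l (restr z l)) :
    Extendible B 0 0 := by
  have : Fact (z ∈ M.sets) := ⟨hz⟩
  refine fun L hL => ⟨restr z L, ?_, fun l b hlb => ?_⟩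
  · simpa [restr_zero] using pre_restr (z := z) hL
  · rw [hlb.unique (pre_restr hlb.le)]
    exact h l

/-- Compactness of Cantor space: a bar contains a finite one. -/
theorem exists_bar (h : ∀ z ∈ M.sets, ∃ l, B l (restr z l)) :
    ∃ L, ∀ c, c < pow2 L → ∃ l b, Pre l b L c ∧ B l b := by
  by_contra! hc
  obtain ⟨l, hl⟩ := h _ (branch_mem_sets (B := B))
  -- If no length bounds the bar, there are avoiding strings of every length, so the leftmost branch
  -- would escape the bar.
  refine not_restr_branch (fun L _ => ?_) l hl
  obtain ⟨c, hcL, hc⟩ := hc L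
  exact ⟨c, pre_zero_iff.2 hcL, hc⟩

end

/-! ### Definability with rational numbers -/

/-- A definable function on assignments whose values are rational numbers. -/
class DefQ (q : (ℕ → M.Num) → Q M) : Prop where
  pos : DefFun fun v => (q v).pos
  neg : DefFun fun v => (q v).neg
  den : DefFun fun v => (q v).den

namespace DefQ

variable {q q' : (ℕ → M.Num) → Q M}

instance [h : DefQ q] : DefFun fun v => (q v).pos := h.pos
instance [h : DefQ q] : DefFun fun v => (q v).neg := h.neg
instance [h : DefQ q] : DefFun fun v => (q v).den := h.den

instance const (q : Q M) : DefQ fun _ => q := ⟨inferInstance, inferInstance, inferInstance⟩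

instance triple {a b c : (ℕ → M.Num) → M.Num} [ha : DefFun a] [hb : DefFun b] [hc : DefFun c] :
    DefQ fun v => ⟨a v, b v, c v⟩ := ⟨ha, hb, hc⟩

instance (priority := low) shift (ρ : ℕ → ℕ) [h : DefQ q] : DefQ fun v => q (fun i => v (ρ i)) :=
  ⟨DefFun.shift (t := fun v => (q v).pos) ρ, DefFun.shift (t := fun v => (q v).neg) ρ,
    DefFun.shift (t := fun v => (q v).den) ρ⟩

instance add [DefQ q] [DefQ q'] : DefQ fun v => q v + q' v := by
  simp only [Rat.Q_add]
  infer_instance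

instance neg' [DefQ q] : DefQ fun v => - q v := by
  simp only [Rat.Q_neg]
  infer_instance

instance sub [DefQ q] [DefQ q'] : DefQ fun v => q v - q' v :=
  add (q' := fun v => - q' v)

instance dyadic {l b : (ℕ → M.Num) → M.Num} [DefFun l] [DefFun b] :
    DefQ fun v => Q.dyadic (l v) (b v) := by
  unfold Q.dyadic
  infer_instance

instance code [DefQ q] : DefFun fun v => (q v).code := by
  unfold Q.code
  infer_instance

instance lt [DefQ q] [DefQ q'] : ADef fun v => q v < q' v := by
  change ADef fun v => (q v).pos * ((q' v).den + 1) + (q' v).neg * ((q v).den + 1) <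
    (q' v).pos * ((q v).den + 1) + (q v).neg * ((q' v).den + 1)
  infer_instance

instance le [DefQ q] [DefQ q'] : ADef fun v => q v ≤ q' v :=
  ADef.not (p := fun v => q' v < q v)

instance all {p : Q M → (ℕ → M.Num) → Prop}
    [ADef fun v => p ⟨v 0, v 1, v 2⟩ (fun i => v (i + 3))] : ADef fun v => ∀ q, p q v :=
  ADef.congr (q := fun v => ∀ c b a, p ⟨a, b, c⟩ v) fun _ =>
    ⟨fun h _ _ _ => h _, fun h q => h q.den q.neg q.pos⟩

instance ex {p : Q M → (ℕ → M.Num) → Prop}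
    [ADef fun v => p ⟨v 0, v 1, v 2⟩ (fun i => v (i + 3))] : ADef fun v => ∃ q, p q v :=
  ADef.congr (q := fun v => ∃ c b a, p ⟨a, b, c⟩ v) fun _ =>
    ⟨fun ⟨q, h⟩ => ⟨q.den, q.neg, q.pos, h⟩, fun ⟨_, _, _, h⟩ => ⟨_, h⟩⟩

end DefQ

/-! ### Constant reals -/

/-- The constant sequence with value `q`. -/
def constReal (q : Q M) : Set M.Num := {z | ∃ n, z = pair n q.code}

theorem hasTerm_constReal {q p : Q M} {n : M.Num} : HasTerm (constReal q) n p ↔ p = q := by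
  constructor
  · rintro ⟨m, hm⟩
    exact Q.code_inj.1 (pair_inj.1 hm).2
  · rintro rfl
    exact ⟨n, rfl⟩

theorem isReal_constReal (q : Q M) : IsReal (constReal q) := by
  refine ⟨setOf_mem _, fun z ⟨n, hz⟩ => ⟨n, q, hz⟩, fun n => ⟨q, hasTerm_constReal.2 rfl,
    fun p hp => hasTerm_constReal.1 hp⟩, fun i j p p' e _ hp hp' he => ?_⟩
  rw [hasTerm_constReal.1 hp, hasTerm_constReal.1 hp', Rat.val_le, Rat.val_sub, he.val, sub_self]
  exact ⟨(hp_pos i).le, (hp_pos i).le⟩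

theorem qltR_constReal {q p : Q M} : QltR p (constReal q) ↔ p.val < q.val := by
  constructor
  · rintro ⟨k, r, e, hr, he, h⟩
    rw [hasTerm_constReal.1 hr, Rat.val_lt, Rat.val_sub, he.val] at h
    linarith [hp_pos k]
  · intro h
    obtain ⟨k, hk⟩ := exists_hp_lt (sub_pos.2 h)
    refine ⟨k, q, Q.dyadic k 1, hasTerm_constReal.2 rfl, Q.isHalfPow_iff.2 rfl, ?_⟩
    rw [Rat.val_lt, Rat.val_sub, Q.val_half]
    linarith

theorem req_refl {x : Set M.Num} (hx : IsReal x) : Req x x := by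
  intro q hq
  rw [Rat.val_lt, Rat.val_zero] at hq
  obtain ⟨k, hk⟩ := exists_hp_lt (half_pos hq)
  obtain ⟨p, hp, -⟩ := hx.2.2.1 k
  refine ⟨k, p, p, Q.dyadic k 1, hp, hp, Q.isHalfPow_iff.2 rfl, ?_⟩
  simp only [Rat.val_lt, Rat.val_add, Rat.val_sub, Q.val_half]
  constructor <;> linarith

/-! ### Cousin's lemma for images of Cantor space -/

/-- A parametrization of a presented space by Cantor space, with a definable relation `Vis` such
that `Vis a r l b` expresses that the image of the set of extensions of the string `b` of length `l`
is visibly contained in the ball of radius `r` about the center `a`. -/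
structure CantorImage (X : Presentation M) where
  pt : Set M.Num → Set M.Num
  Vis : M.Num → Q M → M.Num → M.Num → Prop
  adef_center : ∀ (a : (ℕ → M.Num) → M.Num) [DefFun a], ADef fun v => X.IsCenter (a v)
  adef_vis : ∀ (a : (ℕ → M.Num) → M.Num) (r : (ℕ → M.Num) → Q M) (l b : (ℕ → M.Num) → M.Num)
    [DefFun a] [DefQ r] [DefFun l] [DefFun b], ADef fun v => Vis (a v) (r v) (l v) (b v)
  adef_pt : ∀ (z : (ℕ → M.Num) → Set M.Num) (s : (ℕ → M.Num) → M.Num) [DefFun s]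
    [ADef fun v => v 0 ∈ z (fun i => v (i + 1))], ADef fun v => s v ∈ pt (z v)
  isPoint : ∀ z ∈ M.sets, X.IsPoint (pt z)
  distLT_iff : ∀ z ∈ M.sets, ∀ a r, X.IsCenter a → 0 < r →
    (X.DistLT (pt z) (X.center a) r ↔ ∃ l, Vis a r l (restr z l))
  distLT_congr : ∀ z ∈ M.sets, ∀ z' ∈ M.sets, X.PtEq (pt z) (pt z') → ∀ a r, X.IsCenter a → 0 < r →
    (X.DistLT (pt z) (X.center a) r ↔ X.DistLT (pt z') (X.center a) r)
  cover : ∀ x, X.IsPoint x → ∀ L, ∃ c, c < pow2 L ∧ ∀ l, ∀ z ∈ M.sets, Pre l (restr z l) L c →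
    ∀ q : Q M, hp l < q.val → X.DistLT x (pt z) q

namespace CantorImage

variable {X : Presentation M} (π : CantorImage X) (D : Set M.Num)

/-- All points of the cell `b` at level `l` have, for some `n > N`, `n`-th approximation visibly
less than `2⁻ʲ`. -/
def Below (N j l b : M.Num) : Prop :=
  ∃ n a, ∃ r c s : Q M, N < n ∧ X.Maps (sec D n) a r c s ∧ c + s < Q.dyadic j 1 ∧ π.Vis a r l b

/-- At the point with parameter `z`, the `n`-th approximation is at least `2⁻ʲ` for all `n > N`. -/
def AtLeast (N j : M.Num) (z : Set M.Num) : Prop := ∀ l, ¬ π.Below D N j l (restr z l)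

/-- The strings to be avoided by the points of the cell `b₀` at level `j + 1` at which all
approximations beyond the `N`-th are at least `2⁻ʲ`. -/
def Forbidden (N j b₀ l b : M.Num) : Prop := π.Below D N j l b ∨ (l = j + 1 ∧ b ≠ b₀)

/-- Some point of the cell `b` at level `j + 1` has all approximations beyond the `N`-th at
least `2⁻ʲ`. -/
def Tagged (N j b : M.Num) : Prop := Extendible (fun l b' => π.Forbidden D N j b l b') 0 0

/-- A point of the cell `b` witnessing `Tagged`. -/
def tag (N j b : M.Num) : Set M.Num := branch fun l b' => π.Forbidden D N j b l b'

section Definability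

variable [hD : Fact (D ∈ M.sets)]

instance {N j l b : (ℕ → M.Num) → M.Num} [DefFun N] [DefFun j] [DefFun l] [DefFun b] :
    ADef fun v => π.Below D (N v) (j v) (l v) (b v) := by
  have := π.adef_vis
  have := π.adef_center
  unfold Below Presentation.Maps sec
  simp only [Set.mem_ofPred_eq]
  infer_instance

instance {N j b₀ l b : (ℕ → M.Num) → M.Num} [DefFun N] [DefFun j] [DefFun b₀] [DefFun l]
    [DefFun b] : ADef fun v => π.Forbidden D (N v) (j v) (b₀ v) (l v) (b v) := by
  unfold Forbidden
  infer_instance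

instance {N j b : (ℕ → M.Num) → M.Num} [DefFun N] [DefFun j] [DefFun b] :
    ADef fun v => π.Tagged D (N v) (j v) (b v) := by
  unfold Tagged
  infer_instance

instance {N j b s : (ℕ → M.Num) → M.Num} [DefFun N] [DefFun j] [DefFun b] [DefFun s] :
    ADef fun v => s v ∈ π.tag D (N v) (j v) (b v) := by
  unfold tag
  infer_instance

instance {N j : (ℕ → M.Num) → M.Num} {z : (ℕ → M.Num) → Set M.Num} [DefFun N] [DefFun j]
    [ADef fun v => v 0 ∈ z (fun i => v (i + 1))] : ADef fun v => π.AtLeast D (N v) (j v) (z v) := by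
  have : ADef fun v => v 0 ∈ z (fun i => v (i + 2)) :=
    ADef.subst (p := fun i v => i ∈ z v) (· + 2) (fun v => v 0)
  unfold AtLeast
  infer_instance

theorem tag_mem (N j b : M.Num) : π.tag D N j b ∈ M.sets := branch_mem_sets

theorem Tagged.atLeast {N j b : M.Num} (h : π.Tagged D N j b) :
    π.AtLeast D N j (π.tag D N j b) := fun l hl =>
  not_restr_branch h l (Or.inl hl)

theorem Tagged.restr {N j b : M.Num} (h : π.Tagged D N j b) :
    restr (π.tag D N j b) (j + 1) = b :=
  not_not.1 fun hb => not_restr_branch h (j + 1) (Or.inr ⟨rfl, hb⟩)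

/-- The point z is itself a branch that avoids every forbidden string. -/
theorem AtLeast.tagged {N j : M.Num} {z : Set M.Num} (hz : z ∈ M.sets) (h : π.AtLeast D N j z) :
    π.Tagged D N j (L2Structure.restr z (j + 1)) := by
  refine extendible_of_avoids hz fun l => ?_
  rintro (hl | ⟨rfl, hl⟩)
  exacts [h l hl, hl rfl]

end Definability

variable {D}

/-- Translates the combinatorial condition on initial segments of z into one on the point `π.pt z`.
It follows that the condition depends only on the point, not on its parameter. -/
theorem atLeast_iff {N j : M.Num} {z : Set M.Num} (hz : z ∈ M.sets) : π.AtLeast D N j z ↔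
    ∀ n a, ∀ r c s : Q M, N < n → X.Maps (sec D n) a r c s → (c + s).val < hp j →
      ¬ X.DistLT (π.pt z) (X.center a) r := by
  constructor
  · intro h n a r c s hn hm hcs hd
    obtain ⟨l, hl⟩ := (π.distLT_iff z hz a r hm.1 hm.2.1).1 hd
    exact h l ⟨n, a, r, c, s, hn, hm, by rwa [Rat.val_lt, Q.val_half], hl⟩
  · rintro h l ⟨n, a, r, c, s, hn, hm, hcs, hv⟩
    rw [Rat.val_lt, Q.val_half] at hcs
    exact h n a r c s hn hm hcs ((π.distLT_iff z hz a r hm.1 hm.2.1).2 ⟨l, hv⟩)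

theorem atLeast_congr {N j : M.Num} {z z' : Set M.Num} (hz : z ∈ M.sets) (hz' : z' ∈ M.sets)
    (h : X.PtEq (π.pt z) (π.pt z')) : π.AtLeast D N j z ↔ π.AtLeast D N j z' := by
  rw [π.atLeast_iff hz, π.atLeast_iff hz']
  refine forall₅_congr fun n a r c s => forall₃_congr fun _ hm _ => not_congr ?_
  exact π.distLT_congr z hz z' hz' h a r hm.1 hm.2.1

/-- Positivity of the gauge gives s > 0 with fₙ > s at the point for all large n; any j with 2⁻ʲ < s
works. -/
theorem exists_atLeast (hD : X.IsBaireOneGauge D) {z : Set M.Num} (hz : z ∈ M.sets) :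
    ∃ N j, π.AtLeast D N j z := by
  obtain ⟨s, hs, N, hN⟩ := hD.2 _ (π.isPoint z hz)
  rw [Rat.val_lt, Rat.val_zero] at hs
  obtain ⟨j, hj⟩ := exists_hp_lt hs
  refine ⟨N, j, (π.atLeast_iff hz).2 fun n a r c t hn hm hct hd => ?_⟩
  obtain ⟨y, hy, k, p, e, hp, he, hsp⟩ := hN n hn
  refine (hy.2 a r c t hm hd).2 ⟨k, p, e, hp, he, ?_⟩
  rw [Rat.val_lt] at hsp ⊢
  linarith

theorem AtLeast.valueGT (hD : X.IsBaireOneCode D) {z : Set M.Num} (hz : z ∈ M.sets) {N j : M.Num}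
    (h : π.AtLeast D N j z) {q : Q M} (hq : q.val < hp j) : X.ValueGT D (π.pt z) q := by
  rw [π.atLeast_iff hz] at h
  obtain ⟨s, hs⟩ := Rat.exists_val ((q.val + hp j) / 2)
  -- Of the four parts, two are lost to the radius t of the value ball and two to the precision 2⁻ᵏ
  -- of the real y.
  obtain ⟨ε, hε⟩ := Rat.exists_val ((hp j - s.val) / 4)
  have hε0 : 0 < ε.val := by linarith
  obtain ⟨N', hN'⟩ := hD.2.2 _ (π.isPoint z hz) ε (Rat.val_lt.2 hε0)
  refine ⟨s, Rat.val_lt.2 (by linarith), max N N', fun n hn => ?_⟩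
  rw [max_lt_iff] at hn
  -- The Cauchy clause with both indices equal to n serves only to supply a value of fₙ at the
  -- point.
  obtain ⟨y, -, hy, -⟩ := hN' n n hn.2 hn.2
  refine ⟨y, hy, ?_⟩
  obtain ⟨a, r, c, t, hm, hd, ht⟩ := (hD.2.1 n).2.2.2.2 _ (π.isPoint z hz) ε (Rat.val_lt.2 hε0)
  have h1 : hp j ≤ (c + t).val := not_lt.1 fun hct => h n a r c t hn.1 hm hct hd
  obtain ⟨k, hk⟩ := exists_hp_lt hε0
  obtain ⟨p, hp, -⟩ := hy.1.2.2.1 k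
  have h2 : ¬ p + Q.dyadic k 1 < c - t := fun hlt =>
    (hy.2 a r c t hm hd).1 ⟨k, p, _, hp, Q.isHalfPow_iff.2 rfl, hlt⟩
  refine ⟨k, p, _, hp, Q.isHalfPow_iff.2 rfl, ?_⟩
  simp only [Rat.val_lt, Rat.val_add, Rat.val_sub, Q.val_half, not_lt] at *
  linarith

/-- Cousin's lemma for Baire class 1 gauges on a definable image of Cantor space. -/
theorem cousinBaireOne {X : Presentation M} (π : CantorImage X) : X.CousinBaireOne := by
  intro D hD
  have hDs : Fact (D ∈ M.sets) := ⟨hD.1.1⟩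
  -- The tagged cells form a bar, and it is arithmetical because `Tagged` is.
  obtain ⟨L, hL⟩ := exists_bar (B := fun l b => ∃ N j, l = j + 1 ∧ π.Tagged D N j b) fun z hz => by
    obtain ⟨N, j, h⟩ := π.exists_atLeast hD hz
    exact ⟨j + 1, N, j, rfl, AtLeast.tagged π D hz h⟩
  -- For each string c of length L, a tagged cell containing c and its parameters are picked as
  -- successive least numbers, so that the sequence of witnesses is definable.
  let J : M.Num → M.Num := fun c => least fun j => ∃ N b, Pre (j + 1) b L c ∧ π.Tagged D N j b
  let N : M.Num → M.Num := fun c => least fun N => ∃ b, Pre (J c + 1) b L c ∧ π.Tagged D N (J c) b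
  let b : M.Num → M.Num := fun c => least fun b => Pre (J c + 1) b L c ∧ π.Tagged D (N c) (J c) b
  let Z : M.Num → Set M.Num := fun c => π.tag D (N c) (J c) (b c)
  -- The radius has to be a function of the point, while different cells may share a witness and
  -- have different `J c`. The least admissible exponent depends on the point alone, and it only
  -- enlarges the ball.
  let ρ : M.Num → M.Num := fun c => least fun j => ∃ N, π.AtLeast D N j (Z c)
  have hJ : ∀ (s : (ℕ → M.Num) → M.Num) [DefFun s], DefFun fun v => J (s v) := fun s _ => by
    dsimp only [J]
    infer_instance
  have hN : ∀ (s : (ℕ → M.Num) → M.Num) [DefFun s], DefFun fun v => N (s v) := fun s _ => by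
    dsimp only [N]
    infer_instance
  have hb : ∀ (s : (ℕ → M.Num) → M.Num) [DefFun s], DefFun fun v => b (s v) := fun s _ => by
    dsimp only [b]
    infer_instance
  have hZ : ∀ (s t : (ℕ → M.Num) → M.Num) [DefFun s] [DefFun t], ADef fun v => s v ∈ Z (t v) :=
    fun s t _ _ => by
      dsimp only [Z]
      infer_instance
  have hρ : ∀ (s : (ℕ → M.Num) → M.Num) [DefFun s], DefFun fun v => ρ (s v) := fun s _ => by
    dsimp only [ρ]
    infer_instance
  have hZs : ∀ c, Z c ∈ M.sets := fun c => π.tag_mem D _ _ _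
  have hc : ∀ c, c < pow2 L → Pre (J c + 1) (b c) L c ∧ π.Tagged D (N c) (J c) (b c) := by
    intro c hc
    obtain ⟨l, b', h1, N', j, rfl, h2⟩ := hL c hc
    have h3 : ∃ N b, Pre (J c + 1) b L c ∧ π.Tagged D N (J c) b :=
      least_spec (p := fun j => ∃ N b, Pre (j + 1) b L c ∧ π.Tagged D N j b) ⟨j, N', b', h1, h2⟩
    have h4 : ∃ b, Pre (J c + 1) b L c ∧ π.Tagged D (N c) (J c) b :=
      least_spec (p := fun N => ∃ b, Pre (J c + 1) b L c ∧ π.Tagged D N (J c) b) h3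
    exact least_spec (p := fun b => Pre (J c + 1) b L c ∧ π.Tagged D (N c) (J c) b) h4
  have hρc : ∀ c, c < pow2 L → ρ c ≤ J c ∧ ∃ N, π.AtLeast D N (ρ c) (Z c) := by
    intro c h
    have h1 : ∃ N, π.AtLeast D N (J c) (Z c) := ⟨N c, Tagged.atLeast π D (hc c h).2⟩
    exact ⟨least_le (p := fun j => ∃ N, π.AtLeast D N j (Z c)) h1,
      least_spec (p := fun j => ∃ N, π.AtLeast D N j (Z c)) ⟨_, h1⟩⟩
  have hP : ∀ c, sec {w | ∃ i c, w = pair i c ∧ i ∈ π.pt (Z c)} c = π.pt (Z c) := by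
    intro c
    ext i
    refine ⟨fun ⟨i', c', h, hi⟩ => ?_, fun hi => ⟨i, c, rfl, hi⟩⟩
    obtain ⟨rfl, rfl⟩ := pair_inj.1 h
    exact hi
  have hR : ∀ c, sec {w | ∃ n c, w = pair (pair n (Q.dyadic (ρ c) 1).code) c} c =
      constReal (Q.dyadic (ρ c) 1) := by
    intro c
    ext i
    refine ⟨fun ⟨n, c', h⟩ => ?_, fun ⟨n, hn⟩ => ⟨n, c, by rw [hn]⟩⟩
    obtain ⟨rfl, rfl⟩ := pair_inj.1 h
    exact ⟨n, rfl⟩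
  have hpt := π.adef_pt
  refine ⟨pow2 L, _, setOf_mem fun w => ∃ i c, w = pair i c ∧ i ∈ π.pt (Z c), _,
    setOf_mem fun w => ∃ n c, w = pair (pair n (Q.dyadic (ρ c) 1).code) c, ?_, ?_, ?_⟩
  · intro c h
    rw [hP, hR]
    refine ⟨π.isPoint _ (hZs c), isReal_constReal _, ?_, fun q hq => ?_⟩
    · rw [qltR_constReal, Q.val_half]
      exact hp_pos _
    · rw [qltR_constReal, Q.val_half] at hq
      obtain ⟨N', hN'⟩ := (hρc c h).2
      exact AtLeast.valueGT π hD.1 (hZs c) hN' hq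
  · intro c c' _ _ heq
    rw [hP, hP] at heq
    have : ρ c = ρ c' := by
      simp only [ρ, π.atLeast_congr (hZs c) (hZs c') heq]
    rw [hR, hR, this]
    exact req_refl (isReal_constReal _)
  · intro x hx
    obtain ⟨c, hcL, h⟩ := π.cover x hx L
    obtain ⟨h1, h2⟩ := hc c hcL
    -- The balls are open, which is why cells have level j + 1: q lies strictly between the bound
    -- 2⁻⁽ᴶ⁺¹⁾ on the distance and the radius, which is at least 2⁻ᴶ.
    obtain ⟨q, hq⟩ := Rat.exists_val ((hp (J c + 1) + hp (J c)) / 2)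
    have h3 : hp (J c + 1) < hp (J c) := hp_lt (num_lt_succ_iff.2 le_rfl)
    have h4 := hp_le (hρc c hcL).1
    refine ⟨c, hcL, q, ?_, ?_⟩
    · rw [hP]
      refine h (J c + 1) (Z c) (hZs c) ?_ q (by linarith)
      rwa [Tagged.restr π D h2]
    · rw [hR, qltR_constReal, Q.val_half]
      linarith

end CantorImage

/-! ### Cantor space -/

instance {s t : (ℕ → M.Num) → M.Num} [DefFun s] [DefFun t] : ADef fun v => Bit (s v) (t v) := by
  unfold Bit
  infer_instance

theorem num_even_ne_odd (a b : M.Num) : a + a ≠ b + b + 1 := by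
  intro h
  rcases lt_or_ge b a with hb | hb
  · have := add_le_add (num_succ_le_iff.2 hb) (num_succ_le_iff.2 hb)
    rw [h, show b + 1 + (b + 1) = b + b + 1 + 1 by ring] at this
    exact num_lt_irrefl _ (num_succ_le_iff.1 this)
  · have := add_le_add hb hb
    rw [h] at this
    exact num_lt_irrefl _ (num_succ_le_iff.1 this)

theorem mem_iff_pre {z : Set M.Num} (hz : z ∈ M.sets) {i l : M.Num} (h : i < l) :
    i ∈ z ↔ ∃ c, Pre (i + 1) (c + c + 1) l (restr z l) := by
  have : Fact (z ∈ M.sets) := ⟨hz⟩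
  have h1 : Pre (i + 1) (restr z (i + 1)) l (restr z l) := pre_restr (num_succ_le_iff.2 h)
  rw [restr_succ] at h1
  constructor
  · intro hi
    rw [if_pos hi] at h1
    exact ⟨_, h1⟩
  · rintro ⟨c, hc⟩
    by_contra hi
    rw [if_neg hi] at h1
    exact num_even_ne_odd _ _ (h1.unique hc)

/-- The metric speaks only of the first difference; its existence in M is the least number principle
for sets of the model. -/
theorem exists_first_difference {x y : Set M.Num} (hx : x ∈ M.sets) (hy : y ∈ M.sets)
    {n : M.Num} (h : ¬ (n ∈ x ↔ n ∈ y)) :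
    ∃ n, (∀ i, i < n → (i ∈ x ↔ i ∈ y)) ∧ ¬ (n ∈ x ↔ n ∈ y) := by
  have : Fact (x ∈ M.sets) := ⟨hx⟩
  have : Fact (y ∈ M.sets) := ⟨hy⟩
  obtain ⟨m, hm, hmin⟩ := exists_least (p := fun n => ¬ (n ∈ x ↔ n ∈ y)) ⟨n, h⟩
  exact ⟨m, fun i hi => not_not.1 fun h => (hmin i h).not_gt hi, hm⟩

theorem cantor_distLT_of_agree {x y : Set M.Num} {l : M.Num} (h : ∀ i, i < l → (i ∈ x ↔ i ∈ y))
    {q : Q M} (hq : hp l < q.val) : (cantor M).DistLT x y q := by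
  refine ⟨Rat.val_lt.2 ((hp_pos l).trans hq), fun n _ hn => ⟨_, Q.isHalfPow_iff.2 rfl, ?_⟩⟩
  have hl : l ≤ n := not_lt.1 fun hnl => hn (h n hnl)
  rw [Rat.val_lt, Q.val_half]
  exact (hp_le hl).trans_lt hq

theorem cantor_distLT_iff {x y : Set M.Num} (hx : x ∈ M.sets) (hy : y ∈ M.sets) {q : Q M} :
    (cantor M).DistLT x y q ↔ ∃ l, hp l < q.val ∧ ∀ i, i < l → (i ∈ x ↔ i ∈ y) := by
  refine ⟨fun ⟨h0, h⟩ => ?_, fun ⟨l, hl, h⟩ => cantor_distLT_of_agree h hl⟩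
  by_cases hxy : ∃ n, ¬ (n ∈ x ↔ n ∈ y)
  · obtain ⟨n, hn⟩ := hxy
    obtain ⟨m, hm, hm'⟩ := exists_first_difference hx hy hn
    obtain ⟨e, he, heq⟩ := h m hm hm'
    rw [Rat.val_lt, he.val] at heq
    exact ⟨m, heq, hm⟩
  · push Not at hxy
    obtain ⟨l, hl⟩ := exists_hp_lt (Rat.val_lt.1 h0)
    exact ⟨l, hl, fun i _ => hxy i⟩

theorem cantor_eq_of_ptEq {x y : Set M.Num} (hx : x ∈ M.sets) (hy : y ∈ M.sets)
    (h : (cantor M).PtEq x y) : x = y := by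
  by_contra hne
  obtain ⟨n, hn⟩ : ∃ n, ¬ (n ∈ x ↔ n ∈ y) := by
    by_contra! hc
    exact hne (Set.ext hc)
  obtain ⟨m, hm, hm'⟩ := exists_first_difference hx hy hn
  obtain ⟨e, he, hlt⟩ := (h (Q.dyadic m 1) (by
    rw [Rat.val_lt, Q.val_half]
    exact hp_pos m)).2 m hm hm'
  rw [Rat.val_lt, he.val, Q.val_half] at hlt
  exact lt_irrefl _ hlt

variable (M) in
/-- Cantor space as an image of itself. -/
noncomputable def cantorImage : CantorImage (cantor M) where
  pt z := z
  Vis a r l b := Q.dyadic l 1 < r ∧ ∀ i, i < l → ((∃ c, Pre (i + 1) (c + c + 1) l b) ↔ Bit i a)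
  adef_center _ _ := ADef.true
  adef_vis _ _ _ _ _ _ _ _ := inferInstance
  adef_pt z s _ _ := ADef.subst (p := fun i v => i ∈ z v) (fun i => i) s
  isPoint _ hz := hz
  distLT_iff z hz a r _ _ := by
    refine (cantor_distLT_iff hz (setOf_mem fun i => Bit i a)).trans ?_
    refine exists_congr fun l => ?_
    rw [Rat.val_lt, Q.val_half]
    refine and_congr_right fun _ => forall₂_congr fun i hi => ?_
    rw [← mem_iff_pre hz hi]
    rfl
  distLT_congr z hz z' hz' h a r _ _ := by rw [cantor_eq_of_ptEq hz hz' h]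
  cover x hx L := by
    have : Fact (x ∈ M.sets) := ⟨hx⟩
    refine ⟨restr x L, ?_, fun l z hz h q hq => cantor_distLT_of_agree (fun i hi => ?_) hq⟩
    · rw [← pre_zero_iff]
      simpa [restr_zero] using pre_restr (z := x) (num_nonneg L)
    · rw [mem_iff_pre hx hi, mem_iff_pre hz hi, h.unique (pre_restr h.le)]

/-! ### The unit interval -/

theorem hp_add (k m : M.Num) : hp (k + m) = hp k * hp m := by
  rw [hp, hp, hp, pow2_add, map_mul, one_div_mul_one_div]

theorem ofNum_pow2_mul_hp (k : M.Num) : Rat.ofNum (pow2 k) * hp k = 1 :=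
  mul_one_div_cancel (ofNum_pow2_pos k).ne'

/-- The dyadic interval of an extension is nested in that of its prefix, because a remainder r < 2ᵐ
satisfies (r + 1)2⁻ᵐ ≤ 1. -/
theorem Pre.dyadic_le {l b L c : M.Num} : Pre l b L c →
    (Q.dyadic l b).val ≤ (Q.dyadic L c).val ∧
      (Q.dyadic L c).val + hp L ≤ (Q.dyadic l b).val + hp l := by
  rintro ⟨m, r, rfl, hr, rfl⟩
  have h1 : Rat.ofNum (b * pow2 m + r) * hp (l + m) =
      Rat.ofNum b * hp l + hp l * (Rat.ofNum r * hp m) := by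
    rw [hp_add, map_add, map_mul]
    linear_combination (Rat.ofNum b * hp l) * ofNum_pow2_mul_hp m
  have h2 : (Rat.ofNum r + 1) * hp m ≤ 1 := by
    have h := Rat.ofNum_le.2 (num_succ_le_iff.2 hr)
    rw [map_add, map_one] at h
    exact (mul_le_mul_of_nonneg_right h (hp_pos m).le).trans_eq (ofNum_pow2_mul_hp m)
  have h3 : 0 ≤ hp l * (Rat.ofNum r * hp m) :=
    mul_nonneg (hp_pos l).le (mul_nonneg (Rat.ofNum_nonneg r) (hp_pos m).le)
  have h4 := mul_le_mul_of_nonneg_left h2 (hp_pos l).le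
  rw [Q.val_dyadic, Q.val_dyadic, h1, hp_add]
  constructor <;> linarith

theorem IsReal.near {x : Set M.Num} (hx : IsReal x) {i j : M.Num} {p q : Q M}
    (hij : i ≤ j) (hp' : HasTerm x i p) (hq : HasTerm x j q) :
    p.val - q.val ≤ hp i ∧ q.val - p.val ≤ hp i := by
  rcases hij.lt_or_eq with h | rfl
  · have := hx.2.2.2 i j p q _ h hp' hq (Q.isHalfPow_iff.2 rfl)
    simpa only [Rat.val_le, Rat.val_sub, Q.val_half] using this
  · rw [(hx.2.2.1 i).unique hp' hq, sub_self]
    exact ⟨(hp_pos i).le, (hp_pos i).le⟩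

theorem IsReal.near' {x : Set M.Num} (hx : IsReal x) {i j : M.Num} {p q : Q M}
    (hp' : HasTerm x i p) (hq : HasTerm x j q) : p.val - q.val ≤ hp i + hp j := by
  have hi := hp_pos i
  have hj := hp_pos j
  rcases le_total i j with h | h
  · linarith [(hx.near h hp' hq).1]
  · linarith [(hx.near h hq hp').2]

theorem not_rltQ_of_qltR {x : Set M.Num} (hx : IsReal x) {q : Q M} (h : QltR q x) :
    ¬ RltQ x q := by
  rintro ⟨k, p, e, hp', he, hlt⟩
  obtain ⟨k', p', e', hp'', he', hlt'⟩ := h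
  rw [Rat.val_lt, Rat.val_add, he.val] at hlt
  rw [Rat.val_lt, Rat.val_sub, he'.val] at hlt'
  linarith [hx.near' hp'' hp']

theorem rdistLT_iff {x y : Set M.Num} {q : Q M} : RdistLT x y q ↔ ∃ k, ∃ a b : Q M,
    HasTerm x k a ∧ HasTerm y k b ∧ a.val - b.val + 2 * hp k < q.val ∧
      b.val - a.val + 2 * hp k < q.val := by
  constructor
  · rintro ⟨k, a, b, e, ha, hb, he, h⟩
    simp only [Rat.val_lt, Rat.val_add, Rat.val_sub, he.val, ← two_mul] at h
    exact ⟨k, a, b, ha, hb, h⟩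
  · rintro ⟨k, a, b, ha, hb, h⟩
    refine ⟨k, a, b, _, ha, hb, Q.isHalfPow_iff.2 rfl, ?_⟩
    simpa only [Rat.val_lt, Rat.val_add, Rat.val_sub, Q.val_half, ← two_mul] using h

theorem RdistLT.symm {x y : Set M.Num} {q : Q M} : RdistLT x y q → RdistLT y x q := by
  rintro ⟨k, a, b, e, ha, hb, he, h, h'⟩
  exact ⟨k, b, a, e, hb, ha, he, h', h⟩

theorem RdistLT.congr_left {x y z : Set M.Num} (hx : IsReal x) (hy : IsReal y) (hz : IsReal z)
    -- The strict inequality leaves slack 2η: one η pays for passing from x to y, the other for the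
    -- error term 2 · 2⁻ᵐ at the final index.
    (hxy : Req x y) {q : Q M} (h : RdistLT x z q) : RdistLT y z q := by
  obtain ⟨k, a, c, ha, hc, h1, h2⟩ := rdistLT_iff.1 h
  obtain ⟨η, hη, h1, h2⟩ : ∃ η : M.Rat, 0 < η ∧ a.val - c.val + 2 * hp k + 2 * η ≤ q.val ∧
      c.val - a.val + 2 * hp k + 2 * η ≤ q.val := by
    rcases le_total (a.val - c.val) (c.val - a.val) with h | h
    · exact ⟨(q.val - (c.val - a.val + 2 * hp k)) / 2, by linarith, by linarith, by linarith⟩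
    · exact ⟨(q.val - (a.val - c.val + 2 * hp k)) / 2, by linarith, by linarith, by linarith⟩
  obtain ⟨ε, hε⟩ := Rat.exists_val η
  obtain ⟨k', a', b', ha', hb', h3, h4⟩ := rdistLT_iff.1 (hxy ε (Rat.val_lt.2 (hε ▸ hη)))
  obtain ⟨m, hm⟩ := exists_hp_lt (half_pos hη)
  obtain ⟨b, hb, -⟩ := hy.2.2.1 (max m (max k k'))
  obtain ⟨d, hd, -⟩ := hz.2.2.1 (max m (max k k'))
  have h5 := hp_le (le_max_left m (max k k'))
  have h6 := hy.near ((le_max_right k k').trans (le_max_right m _)) hb' hb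
  have h7 := hz.near ((le_max_left k k').trans (le_max_right m _)) hc hd
  have h8 := hx.near' ha ha'
  have h9 := hx.near' ha' ha
  refine rdistLT_iff.2 ⟨_, b, d, hb, hd, ?_, ?_⟩ <;> linarith [h6.1, h6.2, h7.1, h7.2]

/-- The real number with binary expansion `z`. -/
def binaryReal (z : Set M.Num) : Set M.Num := {w | ∃ n, w = pair n (Q.dyadic n (restr z n)).code}

theorem hasTerm_binaryReal {z : Set M.Num} {n : M.Num} {q : Q M} :
    HasTerm (binaryReal z) n q ↔ q = Q.dyadic n (restr z n) := by
  constructor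
  · rintro ⟨m, hm⟩
    obtain ⟨rfl, h⟩ := pair_inj.1 hm
    exact Q.code_inj.1 h
  · rintro rfl
    exact ⟨n, rfl⟩

theorem isReal_binaryReal {z : Set M.Num} (hz : z ∈ M.sets) : IsReal (binaryReal z) := by
  have : Fact (z ∈ M.sets) := ⟨hz⟩
  refine ⟨setOf_mem _, fun w ⟨n, hw⟩ => ⟨n, _, hw⟩, fun n => ⟨_, hasTerm_binaryReal.2 rfl,
    fun p hp => hasTerm_binaryReal.1 hp⟩, fun i j p p' e hij hp' hp'' he => ?_⟩
  have h := (pre_restr (z := z) hij.le).dyadic_le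
  have hi := hp_pos i
  have hj := hp_pos j
  rw [hasTerm_binaryReal.1 hp', hasTerm_binaryReal.1 hp'']
  simp only [Rat.val_le, Rat.val_sub, he.val]
  constructor <;> linarith [h.1, h.2]

instance {q : (ℕ → M.Num) → Q M} {x : Set M.Num} [Fact (x ∈ M.sets)] [DefQ q] :
    ADef fun v => QltR (q v) x := by
  unfold QltR HasTerm Q.IsHalfPow
  infer_instance

theorem QltR.congr {p q : Q M} (h : p.val = q.val) {x : Set M.Num} : QltR p x → QltR q x := by
  rintro ⟨k, r, e, hr, he, hlt⟩
  exact ⟨k, r, e, hr, he, by rwa [Rat.val_lt, ← h, ← Rat.val_lt]⟩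

theorem exists_dyadic_interval {x : Set M.Num} (hx : (unitInterval M).IsPoint x) (L : M.Num) :
    ∃ c, c < pow2 L ∧ ¬ RltQ x (Q.dyadic L c) ∧ ¬ QltR (Q.dyadic L (c + 1)) x := by
  have : Fact (x ∈ M.sets) := ⟨hx.1.1⟩
  -- Since x ≤ 1, the last cell is a candidate. For the least candidate c, the lower bound c/2ᴸ ≤ x
  -- comes from minimality, or from 0 ≤ x when c = 0.
  have h1 : ¬ QltR (Q.dyadic L (pred (pow2 L) + 1)) x := fun h => hx.2.2 <| h.congr (by
    rw [pred_add_one (pow2_pos L), Q.val_dyadic, ofNum_pow2_mul_hp, Rat.val_one])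
  obtain ⟨c, hc, hmin⟩ := exists_least (p := fun c => ¬ QltR (Q.dyadic L (c + 1)) x) ⟨_, h1⟩
  refine ⟨c, ?_, ?_, hc⟩
  · rw [← pred_add_one (pow2_pos L), num_lt_succ_iff]
    exact hmin _ h1
  · rcases num_eq_zero_or_succ c with rfl | ⟨d, rfl⟩
    · rintro ⟨k, r, e, hr, he, hlt⟩
      refine hx.2.1 ⟨k, r, e, hr, he, ?_⟩
      rw [Rat.val_lt, Q.val_dyadic, map_zero, zero_mul] at hlt
      rwa [Rat.val_lt, Rat.val_zero]
    · refine not_rltQ_of_qltR hx.1 (not_not.1 fun h => ?_)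
      exact num_lt_irrefl _ (num_succ_le_iff.1 (hmin d h))

variable (M) in
/-- The unit interval as the image of Cantor space under binary expansions. -/
noncomputable def unitIntervalImage : CantorImage (unitInterval M) where
  pt := binaryReal
  Vis a r l b := ∃ q : Q M, a = q.code ∧
    (Q.dyadic l b - q) + (Q.dyadic l 1 + Q.dyadic l 1) < r ∧
    (q - Q.dyadic l b) + (Q.dyadic l 1 + Q.dyadic l 1) < r
  adef_center _ _ := by
    unfold unitInterval
    infer_instance
  adef_vis _ _ _ _ _ _ _ _ := inferInstance
  adef_pt z s _ _ := by
    have : ADef fun v => v 0 ∈ z (fun i => v (i + 2)) :=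
      ADef.subst (p := fun i v => i ∈ z v) (· + 2) (fun v => v 0)
    unfold binaryReal
    simp only [Set.mem_ofPred_eq]
    infer_instance
  isPoint z hz := by
    have : Fact (z ∈ M.sets) := ⟨hz⟩
    refine ⟨isReal_binaryReal hz, ?_, ?_⟩
    · rintro ⟨k, p, e, hp', he, hlt⟩
      rw [Rat.val_lt, Rat.val_add, he.val, Rat.val_zero, hasTerm_binaryReal.1 hp',
        Q.val_dyadic] at hlt
      linarith [hp_pos k, mul_nonneg (Rat.ofNum_nonneg (restr z k)) (hp_pos k).le]
    · rintro ⟨k, p, e, hp', he, hlt⟩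
      rw [Rat.val_lt, Rat.val_sub, he.val, Rat.val_one, hasTerm_binaryReal.1 hp'] at hlt
      have h := (pre_restr (z := z) (num_nonneg k)).dyadic_le.2
      rw [restr_zero, hp_zero, Q.val_dyadic 0, map_zero, zero_mul] at h
      linarith [hp_pos k]
  distLT_iff z hz a r ha _ := by
    constructor
    · rintro ⟨k, p, q, e, hp', ⟨n, hq⟩, he, h⟩
      rw [hasTerm_binaryReal.1 hp', Q.isHalfPow_iff.1 he] at h
      exact ⟨k, q, (pair_inj.1 hq).2.symm, h⟩
    · rintro ⟨k, q, rfl, h⟩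
      exact ⟨k, _, q, _, hasTerm_binaryReal.2 rfl, ⟨k, rfl⟩, Q.isHalfPow_iff.2 rfl, h⟩
  distLT_congr z hz z' hz' h a r ha _ := by
    -- Different parameters can give equal reals, as with the two expansions of a dyadic rational,
    -- so invariance of the distance is needed here.
    obtain ⟨q, rfl, -⟩ := ha
    have h1 := isReal_binaryReal hz
    have h2 := isReal_binaryReal hz'
    exact ⟨RdistLT.congr_left h1 h2 (isReal_constReal q) h,
      RdistLT.congr_left h2 h1 (isReal_constReal q) fun q hq => (h q hq).symm⟩
  cover x hx L := by
    obtain ⟨c, hcL, h1, h2⟩ := exists_dyadic_interval hx L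
    refine ⟨c, hcL, fun l z hz hpre q hq => ?_⟩
    have : Fact (z ∈ M.sets) := ⟨hz⟩
    -- The points x and z lie in one closed cell of length 2⁻ˡ. At index k ≥ m the approximation to
    -- x may leave it by 2⁻ᵏ and the definition of distance adds 2 · 2⁻ᵏ, hence the third.
    obtain ⟨m, hm⟩ := exists_hp_lt (show 0 < (q.val - hp l) / 3 by linarith)
    obtain ⟨p, hp', -⟩ := hx.1.2.2.1 (max m l)
    have h3 : ¬ p + Q.dyadic (max m l) 1 < Q.dyadic L c := fun h =>
      h1 ⟨_, p, _, hp', Q.isHalfPow_iff.2 rfl, h⟩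
    have h4 : ¬ Q.dyadic L (c + 1) < p - Q.dyadic (max m l) 1 := fun h =>
      h2 ⟨_, p, _, hp', Q.isHalfPow_iff.2 rfl, h⟩
    have h5 : (Q.dyadic L (c + 1)).val = (Q.dyadic L c).val + hp L := by
      rw [Q.val_dyadic, Q.val_dyadic, map_add, map_one, add_mul, one_mul]
    simp only [Rat.val_lt, Rat.val_add, Rat.val_sub, Q.val_half, not_lt, h5] at h3 h4
    have h6 := hpre.dyadic_le
    have h7 := (pre_restr (z := z) (le_max_right m l)).dyadic_le
    have h8 := hp_le (le_max_left m l)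
    have h9 := hp_pos (max m l)
    refine rdistLT_iff.2 ⟨max m l, p, _, hp', hasTerm_binaryReal.2 rfl, ?_, ?_⟩ <;>
      linarith [h6.1, h6.2, h7.1, h7.2]

end L2Structure

end SOA

/-- `ACA₀` proves Cousin's lemma for Baire class 1 gauges, on Cantor space and on the unit
interval: both statements are true in every model of `ACA₀`. -/
theorem mainTheorem4 (M : SOA.L2Structure.{u}) (hM : M.IsModelACA0) :
    (SOA.L2Structure.cantor M).CousinBaireOne ∧
      (SOA.L2Structure.unitInterval M).CousinBaireOne :=
  have : Fact M.IsModelACA0 := ⟨hM⟩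
  ⟨(SOA.L2Structure.cantorImage M).cousinBaireOne,
    (SOA.L2Structure.unitIntervalImage M).cousinBaireOne⟩
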